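/- **Definitions.** Let $I\subseteq\mathbb R$ be an interval and $m\ge 1$ an integer. A real function $f$ on $I$ is *$m$-monotone* on $I$ if $A\le B$ implies $f(A)\le f(B)$ for all selfadjoint complex $m\times m$ matrices $A,B$ whose eigenvalues lie in $I$. It is *$m$-convex* on $I$ if $f(cA+(1-c)B)\le c\,f(A)+(1-c)f(B)$ for all $c\in[0,1]$ and all such $A,B$. Here $f(A)$ is the functional calculus and $\le$ is the order given by positive semidefiniteness of the difference. A Hermitian $n\times n$ matrix $A$ is *conditionally positive definite* if $\langle x,Ax\rangle\ge 0$ for every $x\in\mathbb C^n$ with $\sum_i x_i=0$. For $n\ge 2$, $Q_n(I)$ is the class of real $C^1$ functions $f$ on $I$ such that for all (not necessarily distinct) $\lambda_1,\dots,\lambda_n\in I$ the Loewner matrix $([\lambda_i,\lambda_j]_f)_{i,j=1}^n$ is conditionally positive definite, where $[s,t]_f=\frac{f(s)-f(t)}{s-t}$ for $s\ne t$ and $[s,s]_f=f'(s)$ (one-sided at an endpoint that belongs to $I$). **Theorem.** Let $n\ge 2$, $0<\alpha\le\infty$ and $f\in Q_n([0,\alpha))$. If $\frac{f(t)-f(0)}{t}$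 is $(n-1)$-monotone on $(0,\alpha)$, then $f$ is $(n-1)$-convex on $[0,\alpha)$. In particular, if $f(0)=0$ and $\frac{f(t)}{t}$ is $(n-1)$-monotone on $(0,\alpha)$, then $f$ is $(n-1)$-convex on $[0,\alpha)$. -/

import Mathlib

open scoped ComplexOrder

/-- The interval `[0, α)` of the real line, for `α ∈ (0, ∞]`. -/
def leftClosedInterval (α : EReal) : Set ℝ := {t : ℝ | 0 ≤ t ∧ (t : EReal) < α}

/-- The open interval `(0, α)` of the real line, for `α ∈ (0, ∞]`. -/
def openInterval (α : EReal) : Set ℝ := {t : ℝ | 0 < t ∧ (t : EReal) < α}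

/-- `f` is `n`-monotone on `I`: `A ≤ B` implies `f(A) ≤ f(B)` for all selfadjoint complex
`n × n` matrices `A`, `B` whose eigenvalues lie in `I`. Here `cfc f A` is the functional
calculus `f(A)`, and `A ≤ B` means that `B - A` is positive semidefinite. -/
def IsMatrixMonotone (n : ℕ) (I : Set ℝ) (f : ℝ → ℝ) : Prop :=
  ∀ A B : Matrix (Fin n) (Fin n) ℂ, A.IsHermitian → B.IsHermitian →
    spectrum ℝ A ⊆ I → spectrum ℝ B ⊆ I →
    (B - A).PosSemidef → (cfc f B - cfc f A).PosSemidef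

/-- `f` is `n`-convex on `I`: `f(c A + (1 - c) B) ≤ c f(A) + (1 - c) f(B)` for all `c ∈ [0, 1]`
and all selfadjoint complex `n × n` matrices `A`, `B` whose eigenvalues lie in `I`. -/
def IsMatrixConvex (n : ℕ) (I : Set ℝ) (f : ℝ → ℝ) : Prop :=
  ∀ A B : Matrix (Fin n) (Fin n) ℂ, A.IsHermitian → B.IsHermitian →
    spectrum ℝ A ⊆ I → spectrum ℝ B ⊆ I →
    ∀ c : ℝ, 0 ≤ c → c ≤ 1 →
      (c • cfc f A + (1 - c) • cfc f B - cfc f (c • A + (1 - c) • B)).PosSemidef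

/-- A Hermitian matrix `A` is conditionally positive definite if `⟨x, A x⟩ ≥ 0` for all
complex vectors `x` whose coordinates sum to zero. -/
def IsCondPosDef {n : ℕ} (A : Matrix (Fin n) (Fin n) ℂ) : Prop :=
  A.IsHermitian ∧
    ∀ x : Fin n → ℂ, ∑ i, x i = 0 → 0 ≤ (dotProduct (star x) (A.mulVec x)).re

open Classical in
/-- The first divided difference `[s, t]_f` of a function on `I`, which is `f'(s)` if `s = t`
(a one-sided derivative at an endpoint that belongs to `I`). -/
noncomputable def dividedDiff (I : Set ℝ) (f : ℝ → ℝ) (s t : ℝ) : ℝ :=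
  if s = t then derivWithin f I s else (f s - f t) / (s - t)

/-- The Loewner matrix `([l i, l j]_f)` as a complex matrix. -/
noncomputable def loewnerMatrix {n : ℕ} (I : Set ℝ) (f : ℝ → ℝ) (l : Fin n → ℝ) :
    Matrix (Fin n) (Fin n) ℂ :=
  Matrix.of fun i j => ((dividedDiff I f (l i) (l j) : ℝ) : ℂ)

/-- The class `Q_n(I)`: real `C¹` functions on `I` all of whose `n × n` Loewner matrices are
conditionally positive definite. The points `l i` need not be distinct. -/
def classQ (n : ℕ) (I : Set ℝ) : Set (ℝ → ℝ) :=
  {f | ContDiffOn ℝ 1 f I ∧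
    ∀ l : Fin n → ℝ, (∀ i, l i ∈ I) → IsCondPosDef (loewnerMatrix I f l)}

open Filter Topology Set
open Complex (normSq)
open scoped Matrix

/-! Write m = n - 1 and h(t) = (f(t) - f(0)) / t. First divided differences of h are second divided
differences [s, t, 0] of f, so m-monotonicity of h makes the matrices ([s_i, s_j, 0]) positive
semidefinite (`IsMatrixMonotone.sum_slopeL_nonneg`). On the other side, m-convexity of f follows
once the matrices ([s_i, s_j, μ]) are positive semidefinite for all μ. In an eigenbasis of X with
eigenvalues d_i, half the second derivative of f at X in the direction H, with matrix K in that
basis, has the form ∑_k ∑_{i,j} conj(K_ki y_i) (K_kj y_j) [d_i, d_k, d_j], a sum of m such forms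
with μ = d_k (`le_qform_polyD₂`). The class Q_n leads from 0 to μ. The μ-derivative of [s, t, μ] is
[s, t, μ, μ], and conditional positivity of the Loewner matrix at μ, s_1, ..., s_m says precisely
that ([s_i, s_j, μ, μ]) is positive semidefinite (`LCPos.sum_nonneg`). So the forms of [s_i, s_j, μ]
increase with μ, starting from nonnegative limits at 0 (`LCPos.qPos`).

The remaining work is regularity, since f is only C¹. Steklov averages commute with divided
differences, hence preserve both kinds of positivity, and gain one derivative; they are used for the
monotonicity in μ and again for the convexity. Matrix derivatives are computed for polynomials only,
by the noncommutative product rule, and results are transferred by C¹ or C² approximation. Divided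
differences of polynomials are themselves polynomials, so coinciding nodes are reached by
continuity. -/

/-! ### Divided differences and the two positivity conditions. -/

/-- The first divided difference of `f`, with `f'` playing the role of the derivative. -/
noncomputable def slopeL (f f' : ℝ → ℝ) (s t : ℝ) : ℝ :=
  if s = t then f' s else (f s - f t) / (s - t)

/-- The second divided difference `[s, t, μ]` of `f` at points `s, t ≠ μ`,
with `f'` playing the role of the derivative. -/
noncomputable def slopeQ (f f' : ℝ → ℝ) (s t μ : ℝ) : ℝ :=
  slopeL (fun r => (f r - f μ) / (r - μ)) (fun r => (f' r - (f r - f μ) / (r - μ)) / (r - μ)) s t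

/-- Positivity of the real quadratic forms of second divided differences at distinct points. -/
def QPos (m : ℕ) (J : Set ℝ) (f f' : ℝ → ℝ) : Prop :=
  ∀ s : Fin m → ℝ, Function.Injective s → (∀ i, s i ∈ J) → ∀ μ ∈ J, (∀ i, s i ≠ μ) →
    ∀ x : Fin m → ℝ, 0 ≤ ∑ i, ∑ j, x i * x j * slopeQ f f' (s i) (s j) μ

/-- Conditional positivity of the real quadratic forms of Loewner matrices at distinct points. -/
def LCPos (n : ℕ) (J : Set ℝ) (f f' : ℝ → ℝ) : Prop :=
  ∀ s : Fin n → ℝ, Function.Injective s → (∀ i, s i ∈ J) →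
    ∀ x : Fin n → ℝ, ∑ i, x i = 0 → 0 ≤ ∑ i, ∑ j, x i * x j * slopeL f f' (s i) (s j)

theorem slopeL_self (f f' : ℝ → ℝ) (s : ℝ) : slopeL f f' s s = f' s := if_pos rfl

theorem slopeL_of_ne (f f' : ℝ → ℝ) {s t : ℝ} (h : s ≠ t) :
    slopeL f f' s t = (f s - f t) / (s - t) := if_neg h

theorem slopeQ_self (f f' : ℝ → ℝ) (s μ : ℝ) :
    slopeQ f f' s s μ = (f' s - (f s - f μ) / (s - μ)) / (s - μ) := if_pos rfl

theorem slopeQ_of_ne (f f' : ℝ → ℝ) {s t : ℝ} (μ : ℝ) (h : s ≠ t) :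
    slopeQ f f' s t μ = ((f s - f μ) / (s - μ) - (f t - f μ) / (t - μ)) / (s - t) := if_neg h

/-- The derivative of `[s, t, μ]` with respect to `μ`, namely `[s, t, μ, μ]`. -/
theorem hasDerivAt_slopeQ {g g' : ℝ → ℝ} {s t μ : ℝ} (hs : s ≠ μ) (ht : t ≠ μ)
    (hg : HasDerivAt g (g' μ) μ) :
    HasDerivAt (fun μ => slopeQ g g' s t μ)
      ((slopeL g g' s t - slopeL g g' s μ - slopeL g g' μ t + g' μ) / ((s - μ) * (t - μ))) μ := by
  have hs' : s - μ ≠ 0 := sub_ne_zero.2 hs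
  have ht' : t - μ ≠ 0 := sub_ne_zero.2 ht
  have hD : ∀ r : ℝ, r - μ ≠ 0 → HasDerivAt (fun μ => (g r - g μ) / (r - μ))
      (((-g' μ) * (r - μ) - (g r - g μ) * (-1)) / (r - μ) ^ 2) μ := fun r hr =>
    (hg.const_sub (g r)).fun_div ((hasDerivAt_id' μ).const_sub r) hr
  rw [slopeL_of_ne _ _ hs, slopeL_of_ne _ _ ht.symm]
  have ht2 : μ - t ≠ 0 := sub_ne_zero.2 ht.symm
  rcases eq_or_ne s t with rfl | h
  · simp only [slopeQ_self, slopeL_self]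
    refine (((hD s hs').const_sub (g' s)).fun_div ((hasDerivAt_id' μ).const_sub s) hs').congr_deriv ?_
    rw [← neg_sub (g s), ← neg_sub s, neg_div_neg_eq]
    field_simp
    ring
  · simp only [slopeQ_of_ne _ _ _ h, slopeL_of_ne _ _ h]
    refine (((hD s hs').fun_sub (hD t ht')).div_const (s - t)).congr_deriv ?_
    have h1 : s - t ≠ 0 := sub_ne_zero.2 h
    have h2 : μ - t = -(t - μ) := by ring
    rw [h2, div_neg]
    generalize g s = a
    generalize g t = b
    generalize g μ = c
    generalize g' μ = d
    field_simp
    ring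

/-- Conditional positivity of `(m + 1) × (m + 1)` Loewner matrices gives positivity of the
`m × m` matrices `[s i, s j, μ, μ]`. -/
theorem LCPos.sum_nonneg {m : ℕ} {J : Set ℝ} {g g' : ℝ → ℝ} (h : LCPos (m + 1) J g g')
    {s : Fin m → ℝ} (hs : Function.Injective s) (hsJ : ∀ i, s i ∈ J) {μ : ℝ} (hμ : μ ∈ J)
    (hsμ : ∀ i, s i ≠ μ) (x : Fin m → ℝ) :
    0 ≤ ∑ i, ∑ j, x i * x j * ((slopeL g g' (s i) (s j) - slopeL g g' (s i) μ
      - slopeL g g' μ (s j) + g' μ) / ((s i - μ) * (s j - μ))) := by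
  -- Dividing by s_i - μ absorbs the denominators of [s_i, s_j, μ, μ]; the coordinate -∑ y_i at the
  -- extra node μ makes the sum zero and produces the terms containing μ.
  set y : Fin m → ℝ := fun i => x i / (s i - μ) with hy
  have key := h (Fin.cons μ s) (Fin.cons_injective_iff.2 ⟨by rintro ⟨i, hi⟩; exact hsμ i hi, hs⟩)
    (Fin.cases hμ hsJ) (Fin.cons (-∑ i, y i) y) (by simp [Fin.sum_univ_succ])
  simp only [Fin.sum_univ_succ, Fin.cons_zero, Fin.cons_succ, slopeL_self] at key
  refine key.trans_eq ?_
  have e : ∀ i j, x i * x j * ((slopeL g g' (s i) (s j) - slopeL g g' (s i) μ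
      - slopeL g g' μ (s j) + g' μ) / ((s i - μ) * (s j - μ))) =
      y i * y j * slopeL g g' (s i) (s j) - y j * (y i * slopeL g g' (s i) μ)
      - y i * (y j * slopeL g g' μ (s j)) + g' μ * (y i * y j) := by
    intro i j
    have := sub_ne_zero.2 (hsμ i)
    have := sub_ne_zero.2 (hsμ j)
    simp only [hy]
    field_simp
  simp only [e, Finset.sum_add_distrib, Finset.sum_sub_distrib, ← Finset.mul_sum, ← Finset.sum_mul]
  generalize (∑ k, y k) = Y
  have e1 : ∑ i, y i * -Y * slopeL g g' (s i) μ =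
      - (Y * ∑ i, y i * slopeL g g' (s i) μ) := by
    rw [Finset.mul_sum, ← Finset.sum_neg_distrib (f := _)]
    exact Finset.sum_congr rfl fun i _ => by ring
  have e2 : ∑ i, -Y * y i * slopeL g g' μ (s i) =
      - (Y * ∑ i, y i * slopeL g g' μ (s i)) := by
    rw [Finset.mul_sum, ← Finset.sum_neg_distrib (f := _)]
    exact Finset.sum_congr rfl fun i _ => by ring
  rw [e1, e2]
  ring

/-! ### Monotonicity in μ for twice differentiable functions. -/

/-- A function with nonnegative derivative off a finite set, at whose points it has two-sided
limits, is monotone off that set. -/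
theorem le_of_hasDerivAt_nonneg_of_tendsto_punctured {F F' : ℝ → ℝ} (T : Finset ℝ) :
    ∀ a b : ℝ, a ≤ b → a ∉ T → b ∉ T →
    (∀ x ∈ Icc a b, x ∉ T → HasDerivAt F (F' x) x ∧ 0 ≤ F' x) →
    (∀ c ∈ T, c ∈ Icc a b → ∃ l, Tendsto F (𝓝[≠] c) (𝓝 l)) → F a ≤ F b := by
  induction T using Finset.induction_on with
  | empty =>
    intro a b hab _ _ hd _
    have hm : MonotoneOn F (Icc a b) := by
      apply monotoneOn_of_deriv_nonneg (convex_Icc a b)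
      · exact fun x hx => (hd x hx (by simp)).1.continuousAt.continuousWithinAt
      · intro x hx
        exact (hd x (interior_subset hx) (by simp)).1.differentiableAt.differentiableWithinAt
      · intro x hx
        rw [(hd x (interior_subset hx) (by simp)).1.deriv]
        exact (hd x (interior_subset hx) (by simp)).2
    exact hm (left_mem_Icc.2 hab) (right_mem_Icc.2 hab) hab
  | insert c T hc ih =>
    intro a b hab ha hb hd hl
    simp only [Finset.mem_insert, not_or] at ha hb hd hl
    -- Near c only c itself is exceptional, so the induction hypothesis applies up to points y close
    -- to c on either side; the common two-sided limit l then links the two halves.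
    have hT : ∀ᶠ y in 𝓝 c, y ∉ T :=
      (T.finite_toSet.isClosed.isOpen_compl).mem_nhds (by simpa using hc)
    by_cases hcI : c ∈ Icc a b
    · obtain ⟨l, hlim⟩ := hl c (Or.inl rfl) hcI
      have hac : a < c := lt_of_le_of_ne hcI.1 ha.1
      have hcb : c < b := lt_of_le_of_ne hcI.2 (Ne.symm hb.1)
      have h1 : F a ≤ l := by
        refine ge_of_tendsto (hlim.mono_left (nhdsLT_le_nhdsNE c)) ?_
        filter_upwards [self_mem_nhdsWithin, nhdsWithin_le_nhds hT,
          nhdsWithin_le_nhds (Ioi_mem_nhds hac)] with y hy hyT hya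
        have hy : y < c := hy
        refine ih a y (le_of_lt hya) ha.2 hyT (fun x hx hxT => hd x ⟨hx.1, ?_⟩ ⟨?_, hxT⟩)
          (fun d hd' hdI => hl d (Or.inr hd') ⟨hdI.1, ?_⟩)
        · linarith [hx.2]
        · exact (lt_of_le_of_lt hx.2 hy).ne
        · linarith [hdI.2]
      have h2 : l ≤ F b := by
        refine le_of_tendsto (hlim.mono_left (nhdsGT_le_nhdsNE c)) ?_
        filter_upwards [self_mem_nhdsWithin, nhdsWithin_le_nhds hT,
          nhdsWithin_le_nhds (Iio_mem_nhds hcb)] with y hy hyT hyb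
        have hy : c < y := hy
        refine ih y b (le_of_lt hyb) hyT hb.2 (fun x hx hxT => hd x ⟨?_, hx.2⟩ ⟨?_, hxT⟩)
          (fun d hd' hdI => hl d (Or.inr hd') ⟨?_, hdI.2⟩)
        · linarith [hx.1]
        · exact (lt_of_lt_of_le hy hx.1).ne'
        · linarith [hdI.1]
      exact h1.trans h2
    · refine ih a b hab ha.2 hb.2 (fun x hx hxT => hd x hx ⟨?_, hxT⟩)
        (fun d hd' hdI => hl d (Or.inr hd') hdI)
      rintro rfl
      exact hcI hx

theorem tendsto_slope_punctured {g g' : ℝ → ℝ} {c : ℝ} (hg : HasDerivAt g (g' c) c) (s : ℝ) :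
    ∃ l, Tendsto (fun μ => (g s - g μ) / (s - μ)) (𝓝[≠] c) (𝓝 l) := by
  rcases eq_or_ne s c with rfl | h
  · refine ⟨g' s, (hasDerivAt_iff_tendsto_slope.1 hg).congr fun μ => ?_⟩
    rw [slope_def_field, ← neg_sub (g s), ← neg_sub s, neg_div_neg_eq]
  · have : ContinuousAt (fun μ => (g s - g μ) / (s - μ)) c :=
      (continuousAt_const.sub hg.continuousAt).div (continuousAt_const.sub continuousAt_id)
        (sub_ne_zero.2 h)
    exact ⟨_, this.tendsto.mono_left nhdsWithin_le_nhds⟩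

/-- Second-order Taylor expansion, by l'Hôpital's rule. This limit of [s, s, μ] as μ → s is what
requires g' to be differentiable, and hence why C¹ functions are averaged first. -/
theorem tendsto_slopeQ_self_punctured {g g' : ℝ → ℝ} {s l : ℝ}
    (hg : ∀ᶠ μ in 𝓝 s, HasDerivAt g (g' μ) μ) (hg' : HasDerivAt g' l s) :
    Tendsto (fun μ => slopeQ g g' s s μ) (𝓝[≠] s) (𝓝 (l / 2)) := by
  have key : Tendsto (fun μ => (g μ - g s - g' s * (μ - s)) / (μ - s) ^ 2) (𝓝[≠] s)
      (𝓝 (l / 2)) := by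
    refine HasDerivAt.lhopital_zero_nhdsNE (f' := fun μ => g' μ - g' s)
      (g' := fun μ => 2 * (μ - s)) ?_ ?_ ?_ ?_ ?_ ?_
    · filter_upwards [nhdsWithin_le_nhds hg] with μ hμ
      simpa using (hμ.sub_const (g s)).fun_sub (((hasDerivAt_id μ).sub_const s).const_mul (g' s))
    · refine Eventually.of_forall fun μ => ?_
      simpa using ((hasDerivAt_id μ).sub_const s).fun_pow 2
    · filter_upwards [self_mem_nhdsWithin] with μ hμ
      exact mul_ne_zero two_ne_zero (sub_ne_zero.2 hμ)
    · have : ContinuousAt (fun μ => g μ - g s - g' s * (μ - s)) s :=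
        (hg.self_of_nhds.continuousAt.sub continuousAt_const).sub
          (continuousAt_const.mul (continuousAt_id.sub continuousAt_const))
      simpa [ContinuousAt] using this.tendsto.mono_left nhdsWithin_le_nhds
    · have : ContinuousAt (fun μ : ℝ => (μ - s) ^ 2) s := by fun_prop
      simpa [ContinuousAt] using this.tendsto.mono_left nhdsWithin_le_nhds
    · refine ((hasDerivAt_iff_tendsto_slope.1 hg').div_const 2).congr fun μ => ?_
      rw [slope_def_field, div_div, mul_comm]
  refine key.congr' ?_
  filter_upwards [self_mem_nhdsWithin] with μ hμ
  have h1 : μ - s ≠ 0 := sub_ne_zero.2 hμ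
  have h2 : s - μ ≠ 0 := sub_ne_zero.2 (Ne.symm hμ)
  rw [slopeQ_self, show s - μ = -(μ - s) by ring]
  field_simp
  ring

/-- Off the nodes the μ-derivative is the form of [s_i, s_j, μ, μ], nonnegative by
`LCPos.sum_nonneg`. The nodes between ν and μ are removable singularities, which cannot break
monotonicity. -/
theorem LCPos.sum_slopeQ_le {m : ℕ} {J : Set ℝ} (hJ : IsOpen J) (hJ' : J.OrdConnected)
    {g g' g'' : ℝ → ℝ} (hg : ∀ t ∈ J, HasDerivAt g (g' t) t)
    (hg' : ∀ t ∈ J, HasDerivAt g' (g'' t) t) (h : LCPos (m + 1) J g g')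
    {s : Fin m → ℝ} (hs : Function.Injective s) (hsJ : ∀ i, s i ∈ J) {ν μ : ℝ} (hν : ν ∈ J)
    (hμ : μ ∈ J) (hνμ : ν ≤ μ) (hsν : ∀ i, s i ≠ ν) (hsμ : ∀ i, s i ≠ μ) (x : Fin m → ℝ) :
    ∑ i, ∑ j, x i * x j * slopeQ g g' (s i) (s j) ν ≤
      ∑ i, ∑ j, x i * x j * slopeQ g g' (s i) (s j) μ := by
  have hI : Icc ν μ ⊆ J := hJ'.out hν hμ
  refine le_of_hasDerivAt_nonneg_of_tendsto_punctured
    (F := fun μ => ∑ i, ∑ j, x i * x j * slopeQ g g' (s i) (s j) μ)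
    (F' := fun μ => ∑ i, ∑ j, x i * x j * ((slopeL g g' (s i) (s j) - slopeL g g' (s i) μ
      - slopeL g g' μ (s j) + g' μ) / ((s i - μ) * (s j - μ))))
    (Finset.univ.image s) ν μ hνμ (by simpa using hsν) (by simpa using hsμ) ?_ ?_
  · intro c hc hcT
    have hsc : ∀ i, s i ≠ c := by simpa using hcT
    refine ⟨?_, h.sum_nonneg hs hsJ (hI hc) hsc x⟩
    refine HasDerivAt.fun_sum fun i _ => HasDerivAt.fun_sum fun j _ => ?_
    exact (hasDerivAt_slopeQ (hsc i) (hsc j) (hg c (hI hc))).const_mul _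
  · intro c _ hc
    have hcJ := hI hc
    have hlim : ∀ i j, ∃ l, Tendsto (fun μ => slopeQ g g' (s i) (s j) μ) (𝓝[≠] c) (𝓝 l) := by
      intro i j
      obtain ⟨l1, h1⟩ := tendsto_slope_punctured (hg c hcJ) (s i)
      obtain ⟨l2, h2⟩ := tendsto_slope_punctured (hg c hcJ) (s j)
      rcases eq_or_ne i j with rfl | hij
      · rcases eq_or_ne (s i) c with rfl | hic
        · exact ⟨_, tendsto_slopeQ_self_punctured
            (eventually_of_mem (hJ.mem_nhds hcJ) hg) (hg' _ hcJ)⟩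
        · simp only [slopeQ_self]
          refine ⟨_, (tendsto_const_nhds.sub h1).div (b := s i - c) ?_ (sub_ne_zero.2 hic)⟩
          have : ContinuousAt (fun μ => s i - μ) c := by fun_prop
          exact this.tendsto.mono_left nhdsWithin_le_nhds
      · simp only [slopeQ_of_ne _ _ _ (hs.ne hij)]
        exact ⟨_, (h1.sub h2).div_const _⟩
    choose l hl using hlim
    exact ⟨_, tendsto_finsetSum _ fun i _ => tendsto_finsetSum _ fun j _ =>
      (hl i j).const_mul (x i * x j)⟩

/-! ### Steklov averages. -/

/-- The Steklov average of `f` over `[t, t + ε]`. -/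
noncomputable def steklov (f : ℝ → ℝ) (ε t : ℝ) : ℝ := ε⁻¹ * ∫ u in (0 : ℝ)..ε, f (t + u)

theorem ContinuousOn.comp_const_add {f : ℝ → ℝ} {t ε : ℝ} (hf : ContinuousOn f (Icc t (t + ε))) :
    ContinuousOn (fun u => f (t + u)) (Icc 0 ε) :=
  hf.comp (by fun_prop) fun u hu => ⟨by linarith [hu.1], by linarith [hu.2]⟩

theorem intervalIntegrable_comp_const_add {f : ℝ → ℝ} {t ε : ℝ} (hε : 0 ≤ ε)
    (hf : ContinuousOn f (Icc t (t + ε))) :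
    IntervalIntegrable (fun u => f (t + u)) MeasureTheory.volume 0 ε :=
  hf.comp_const_add.intervalIntegrable_of_Icc hε

theorem hasDerivAt_steklov {J : Set ℝ} (hJ : IsOpen J) (hJ' : J.OrdConnected) {f : ℝ → ℝ}
    (hf : ContinuousOn f J) {ε t : ℝ} (ht : t ∈ J) (htε : t + ε ∈ J) :
    HasDerivAt (steklov f ε) ((f (t + ε) - f t) / ε) t := by
  have hint : ∀ {a b}, a ∈ J → b ∈ J → IntervalIntegrable f MeasureTheory.volume a b :=
    fun ha hb => (hf.mono (hJ'.uIcc_subset ha hb)).intervalIntegrable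
  have hmeas : ∀ {b}, b ∈ J → StronglyMeasurableAtFilter f (𝓝 b) :=
    fun hb => hf.stronglyMeasurableAtFilter hJ _ hb
  have h1 : HasDerivAt (fun x => ∫ u in t..x, f u) (f (t + ε)) (t + ε) :=
    intervalIntegral.integral_hasDerivAt_right (hint ht htε) (hmeas htε)
      (hf.continuousAt (hJ.mem_nhds htε))
  have h1' : HasDerivAt (fun x => ∫ u in t..(x + ε), f u) (f (t + ε)) t :=
    h1.comp_add_const t ε
  have h2 : HasDerivAt (fun x => ∫ u in t..x, f u) (f t) t :=
    intervalIntegral.integral_hasDerivAt_right (hint ht ht) (hmeas ht)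
      (hf.continuousAt (hJ.mem_nhds ht))
  rw [div_eq_inv_mul]
  refine ((h1'.fun_sub h2).const_mul ε⁻¹).congr_of_eventuallyEq ?_
  have hc : ContinuousAt (fun x : ℝ => x + ε) t := by fun_prop
  filter_upwards [hJ.mem_nhds ht, hc.preimage_mem_nhds (hJ.mem_nhds htε)] with x hx hxε
  rw [steklov, intervalIntegral.integral_interval_sub_left (hint ht hxε) (hint ht hx),
    intervalIntegral.integral_comp_add_left, add_zero]

/-- With `hasDerivAt_steklov`, this makes the average of f' the derivative of the average of f, so
averaging both members of a pair (f, f') gives such a pair again. -/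
theorem steklov_deriv {f f' : ℝ → ℝ} {ε t : ℝ} (hε : 0 ≤ ε)
    (hf : ∀ r ∈ Icc t (t + ε), HasDerivAt f (f' r) r) (hf' : ContinuousOn f' (Icc t (t + ε))) :
    steklov f' ε t = (f (t + ε) - f t) / ε := by
  rw [steklov, div_eq_inv_mul]
  congr 1
  rw [intervalIntegral.integral_eq_sub_of_hasDerivAt (f := fun u => f (t + u)) ?_
    (intervalIntegrable_comp_const_add hε hf'), add_zero]
  intro u hu
  rw [uIcc_of_le hε] at hu
  exact (hf (t + u) ⟨by linarith [hu.1], by linarith [hu.2]⟩).comp_const_add t u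

/-- The averaging window lies to the right of t, so continuity on the right suffices and endpoints
are allowed. The shift c is 0 at interior points and 1 when the window must stay off the endpoint 0.
-/
theorem tendsto_steklov {f : ℝ → ℝ} {t η c : ℝ} (hη : 0 < η) (hc : 0 ≤ c)
    (hf : ContinuousOn f (Icc t (t + η))) :
    Tendsto (fun ε => steklov f ε (t + c * ε)) (𝓝[>] 0) (𝓝 (f t)) := by
  rw [Metric.tendsto_nhds]
  intro e he
  have hft := hf t ⟨le_rfl, by linarith⟩
  obtain ⟨δ, hδ, hfδ⟩ := Metric.continuousWithinAt_iff.1 hft (e / 2) (half_pos he)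
  have hsmall : ∀ᶠ ε : ℝ in 𝓝[>] 0, (c + 1) * ε < min δ η := by
    have : ContinuousAt (fun ε : ℝ => (c + 1) * ε) 0 := by fun_prop
    have h := this.tendsto.eventually_lt_const (u := min δ η) (by simp [hδ, hη])
    exact nhdsWithin_le_nhds h
  filter_upwards [self_mem_nhdsWithin, hsmall] with ε hε hlt
  have hε : 0 < ε := hε
  obtain ⟨hlt1, hlt2⟩ := lt_min_iff.1 hlt
  have hcε : 0 ≤ c * ε := by positivity
  have hint : IntervalIntegrable (fun u => f (t + c * ε + u)) MeasureTheory.volume 0 ε :=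
    intervalIntegrable_comp_const_add hε.le
      (hf.mono (Icc_subset_Icc (by linarith) (by linarith)))
  have hbound : ‖∫ u in (0 : ℝ)..ε, (f (t + c * ε + u) - f t)‖ ≤ e / 2 * |ε - 0| := by
    refine intervalIntegral.norm_integral_le_of_norm_le_const fun u hu => ?_
    rw [uIoc_of_le hε.le] at hu
    have := hfδ (x := t + c * ε + u) ⟨by linarith [hu.1], by linarith [hu.2]⟩ (by
      rw [Real.dist_eq, abs_of_nonneg] <;> linarith [hu.1, hu.2])
    exact this.le
  rw [intervalIntegral.integral_sub hint (by simp), intervalIntegral.integral_const, sub_zero,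
    abs_of_pos hε, Real.norm_eq_abs, smul_eq_mul] at hbound
  have e1 : steklov f ε (t + c * ε) - f t =
      ε⁻¹ * ((∫ u in (0 : ℝ)..ε, f (t + c * ε + u)) - ε * f t) := by
    rw [steklov]
    field_simp
  rw [Real.dist_eq, e1, abs_mul, abs_of_pos (inv_pos.2 hε)]
  calc ε⁻¹ * _ ≤ ε⁻¹ * (e / 2 * ε) := by gcongr
    _ = e / 2 := by field_simp
    _ < e := half_lt_self he

/-- Translating both nodes by u leaves s - t unchanged, so the divided difference is linear in the
translated values and commutes with the average over u. -/
theorem slopeL_steklov {f f' : ℝ → ℝ} {ε s t : ℝ} (hε : 0 ≤ ε)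
    (hfs : ContinuousOn f (Icc s (s + ε))) (hft : ContinuousOn f (Icc t (t + ε))) :
    slopeL (steklov f ε) (steklov f' ε) s t =
      ε⁻¹ * ∫ u in (0 : ℝ)..ε, slopeL f f' (s + u) (t + u) := by
  rcases eq_or_ne s t with rfl | h
  · simp only [slopeL_self, steklov]
  · have h' : ∀ u, s + u ≠ t + u := fun u => by simpa using h
    simp only [slopeL_of_ne _ _ h, slopeL_of_ne _ _ (h' _), steklov, add_sub_add_right_eq_sub,
      intervalIntegral.integral_div, ← mul_sub, mul_div_assoc]
    rw [intervalIntegral.integral_sub (intervalIntegrable_comp_const_add hε hfs)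
      (intervalIntegrable_comp_const_add hε hft)]

theorem intervalIntegrable_slopeL {f f' : ℝ → ℝ} {ε s t : ℝ} (hε : 0 ≤ ε)
    (hfs : ContinuousOn f (Icc s (s + ε))) (hft : ContinuousOn f (Icc t (t + ε)))
    (hfs' : ContinuousOn f' (Icc s (s + ε))) :
    IntervalIntegrable (fun u => slopeL f f' (s + u) (t + u)) MeasureTheory.volume 0 ε := by
  rcases eq_or_ne s t with rfl | h
  · simpa only [slopeL_self] using intervalIntegrable_comp_const_add hε hfs'
  · have h' : ∀ u, s + u ≠ t + u := fun u => by simpa using h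
    simp only [slopeL_of_ne _ _ (h' _), add_sub_add_right_eq_sub]
    exact ((intervalIntegrable_comp_const_add hε hfs).sub
      (intervalIntegrable_comp_const_add hε hft)).div_const _

theorem slopeQ_steklov {f f' : ℝ → ℝ} {ε s t μ : ℝ} (hε : 0 ≤ ε)
    (hfs : ContinuousOn f (Icc s (s + ε))) (hft : ContinuousOn f (Icc t (t + ε)))
    (hfμ : ContinuousOn f (Icc μ (μ + ε))) (hfs' : ContinuousOn f' (Icc s (s + ε))) :
    slopeQ (steklov f ε) (steklov f' ε) s t μ =
      ε⁻¹ * ∫ u in (0 : ℝ)..ε, slopeQ f f' (s + u) (t + u) (μ + u) := by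
  have is := intervalIntegrable_comp_const_add hε hfs
  have it := intervalIntegrable_comp_const_add hε hft
  have iμ := intervalIntegrable_comp_const_add hε hfμ
  have is' := intervalIntegrable_comp_const_add hε hfs'
  rcases eq_or_ne s t with rfl | h
  · simp only [slopeQ_self, steklov, add_sub_add_right_eq_sub, intervalIntegral.integral_div]
    rw [intervalIntegral.integral_sub is' ((is.sub iμ).div_const _), intervalIntegral.integral_div,
      intervalIntegral.integral_sub is iμ]
    ring
  · have h' : ∀ u, s + u ≠ t + u := fun u => by simpa using h
    simp only [slopeQ_of_ne _ _ _ h, slopeQ_of_ne _ _ _ (h' _), steklov, add_sub_add_right_eq_sub,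
      intervalIntegral.integral_div]
    rw [intervalIntegral.integral_sub ((is.sub iμ).div_const _) ((it.sub iμ).div_const _),
      intervalIntegral.integral_div, intervalIntegral.integral_div,
      intervalIntegral.integral_sub is iμ, intervalIntegral.integral_sub it iμ]
    ring

theorem intervalIntegrable_slopeQ {f f' : ℝ → ℝ} {ε s t μ : ℝ} (hε : 0 ≤ ε)
    (hfs : ContinuousOn f (Icc s (s + ε))) (hft : ContinuousOn f (Icc t (t + ε)))
    (hfμ : ContinuousOn f (Icc μ (μ + ε))) (hfs' : ContinuousOn f' (Icc s (s + ε))) :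
    IntervalIntegrable (fun u => slopeQ f f' (s + u) (t + u) (μ + u))
      MeasureTheory.volume 0 ε := by
  have is := intervalIntegrable_comp_const_add hε hfs
  have it := intervalIntegrable_comp_const_add hε hft
  have iμ := intervalIntegrable_comp_const_add hε hfμ
  have is' := intervalIntegrable_comp_const_add hε hfs'
  rcases eq_or_ne s t with rfl | h
  · simp only [slopeQ_self, add_sub_add_right_eq_sub]
    exact (is'.sub ((is.sub iμ).div_const _)).div_const _
  · have h' : ∀ u, s + u ≠ t + u := fun u => by simpa using h
    simp only [slopeQ_of_ne _ _ _ (h' _), add_sub_add_right_eq_sub]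
    exact (((is.sub iμ).div_const _).sub ((it.sub iμ).div_const _)).div_const _

theorem sum_average_nonneg {m : ℕ} {ε : ℝ} (hε : 0 ≤ ε) {K : Fin m → Fin m → ℝ → ℝ}
    {x : Fin m → ℝ}
    (hK : ∀ i j, IntervalIntegrable (K i j) MeasureTheory.volume 0 ε)
    (h : ∀ u ∈ Icc 0 ε, 0 ≤ ∑ i, ∑ j, x i * x j * K i j u) :
    0 ≤ ∑ i, ∑ j, x i * x j * (ε⁻¹ * ∫ u in (0 : ℝ)..ε, K i j u) := by
  have e : ∑ i, ∑ j, x i * x j * (ε⁻¹ * ∫ u in (0 : ℝ)..ε, K i j u) =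
      ε⁻¹ * ∫ u in (0 : ℝ)..ε, ∑ i, ∑ j, x i * x j * K i j u := by
    rw [intervalIntegral.integral_finsetSum fun i _ =>
      (by simpa only [Finset.sum_fn] using IntervalIntegrable.sum Finset.univ fun j _ => (hK i j).const_mul (x i * x j)),
      Finset.mul_sum]
    refine Finset.sum_congr rfl fun i _ => ?_
    rw [intervalIntegral.integral_finsetSum fun j _ => (hK i j).const_mul _, Finset.mul_sum]
    refine Finset.sum_congr rfl fun j _ => ?_
    rw [intervalIntegral.integral_const_mul]
    ring
  rw [e]
  exact mul_nonneg (inv_nonneg.2 hε) (intervalIntegral.integral_nonneg hε h)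

/-- The averaged form is the average of the forms at the translated nodes s_i + u, which stay
distinct and inside J. -/
theorem LCPos.steklov {n : ℕ} {J J' : Set ℝ} {f f' : ℝ → ℝ} (h : LCPos n J f f') {ε : ℝ}
    (hε : 0 ≤ ε) (hf : ContinuousOn f J) (hf' : ContinuousOn f' J)
    (hJ' : ∀ t ∈ J', Icc t (t + ε) ⊆ J) : LCPos n J' (steklov f ε) (steklov f' ε) := by
  intro s hs hsJ x hx
  have c1 := fun i => hf.mono (hJ' (s i) (hsJ i))
  have c2 := fun i => hf'.mono (hJ' (s i) (hsJ i))
  simp only [slopeL_steklov hε (c1 _) (c1 _)]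
  refine sum_average_nonneg hε (fun i j => intervalIntegrable_slopeL hε (c1 i) (c1 j) (c2 i))
    fun u hu => h (fun i => s i + u) (fun i j hij => hs (add_right_cancel hij))
      (fun i => hJ' _ (hsJ i) ⟨by linarith [hu.1], by linarith [hu.2]⟩) x hx

theorem QPos.steklov {m : ℕ} {J J' : Set ℝ} {f f' : ℝ → ℝ} (h : QPos m J f f') {ε : ℝ}
    (hε : 0 ≤ ε) (hf : ContinuousOn f J) (hf' : ContinuousOn f' J)
    (hJ' : ∀ t ∈ J', Icc t (t + ε) ⊆ J) : QPos m J' (steklov f ε) (steklov f' ε) := by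
  intro s hs hsJ μ hμ hsμ x
  have c1 := fun i => hf.mono (hJ' (s i) (hsJ i))
  have c2 := fun i => hf'.mono (hJ' (s i) (hsJ i))
  have c3 := hf.mono (hJ' μ hμ)
  simp only [slopeQ_steklov hε (c1 _) (c1 _) c3 (c2 _)]
  refine sum_average_nonneg hε (fun i j => intervalIntegrable_slopeQ hε (c1 i) (c1 j) c3 (c2 i))
    fun u hu => h (fun i => s i + u) (fun i j hij => hs (add_right_cancel hij))
      (fun i => hJ' _ (hsJ i) ⟨by linarith [hu.1], by linarith [hu.2]⟩) (μ + u)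
      (hJ' μ hμ ⟨by linarith [hu.1], by linarith [hu.2]⟩)
      (fun i hi => hsμ i (add_right_cancel hi)) x

theorem tendsto_slopeQ {ι : Type*} {l : Filter ι} {F F' : ι → ℝ → ℝ} {f f' : ℝ → ℝ} {s t μ : ℝ}
    (hs : Tendsto (fun k => F k s) l (𝓝 (f s))) (ht : Tendsto (fun k => F k t) l (𝓝 (f t)))
    (hμ : Tendsto (fun k => F k μ) l (𝓝 (f μ))) (hs' : Tendsto (fun k => F' k s) l (𝓝 (f' s))) :
    Tendsto (fun k => slopeQ (F k) (F' k) s t μ) l (𝓝 (slopeQ f f' s t μ)) := by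
  rcases eq_or_ne s t with rfl | h
  · simp only [slopeQ_self]
    exact (hs'.sub ((hs.sub hμ).div_const _)).div_const _
  · simp only [slopeQ_of_ne _ _ _ h]
    exact (((hs.sub hμ).div_const _).sub ((ht.sub hμ).div_const _)).div_const _

/-! ### From the base point 0 to every μ > 0, for C¹ functions. -/

/-- Monotonicity in `μ` of the quadratic forms of `[s i, s j, μ]`, for `C¹` functions. -/
theorem LCPos.sum_slopeQ_le_of_continuousOn {m : ℕ} {J : Set ℝ} (hJ : IsOpen J)
    (hJ' : J.OrdConnected) {f f' : ℝ → ℝ} (hf : ∀ t ∈ J, HasDerivAt f (f' t) t)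
    (hf' : ContinuousOn f' J) (h : LCPos (m + 1) J f f')
    {s : Fin m → ℝ} (hs : Function.Injective s) (hsJ : ∀ i, s i ∈ J) {ν μ : ℝ} (hν : ν ∈ J)
    (hμ : μ ∈ J) (hνμ : ν ≤ μ) (hsν : ∀ i, s i ≠ ν) (hsμ : ∀ i, s i ≠ μ) (x : Fin m → ℝ) :
    ∑ i, ∑ j, x i * x j * slopeQ f f' (s i) (s j) ν ≤
      ∑ i, ∑ j, x i * x j * slopeQ f f' (s i) (s j) μ := by
  have hfc : ContinuousOn f J := fun t ht => (hf t ht).continuousAt.continuousWithinAt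
  have hlim : ∀ {g : ℝ → ℝ}, ContinuousOn g J → ∀ t ∈ J,
      Tendsto (fun ε => _root_.steklov g ε t) (𝓝[>] 0) (𝓝 (g t)) := by
    intro g hg t ht
    obtain ⟨η, hη, hsub⟩ := Metric.isOpen_iff.1 hJ t ht
    have hI : Icc t (t + η / 2) ⊆ J := fun y hy => hsub (by
      rw [Metric.mem_ball, Real.dist_eq, abs_of_nonneg] <;> linarith [hy.1, hy.2])
    simpa using tendsto_steklov (c := 0) (half_pos hη) le_rfl (hg.mono hI)
  have hq : ∀ μ ∈ J, Tendsto (fun ε => ∑ i, ∑ j, x i * x j *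
      slopeQ (_root_.steklov f ε) (_root_.steklov f' ε) (s i) (s j) μ) (𝓝[>] 0)
      (𝓝 (∑ i, ∑ j, x i * x j * slopeQ f f' (s i) (s j) μ)) := fun μ hμ =>
    tendsto_finsetSum _ fun i _ => tendsto_finsetSum _ fun j _ => (tendsto_slopeQ
      (hlim hfc _ (hsJ i)) (hlim hfc _ (hsJ j)) (hlim hfc _ hμ) (hlim hf' _ (hsJ i))).const_mul _
  refine le_of_tendsto_of_tendsto (hq ν hν) (hq μ hμ) ?_
  have hmem : ∀ t ∈ J, ∀ᶠ ε : ℝ in 𝓝[>] 0, t + ε ∈ J := fun t ht => by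
    have : ContinuousAt (fun ε : ℝ => t + ε) 0 := by fun_prop
    exact nhdsWithin_le_nhds (this.preimage_mem_nhds (hJ.mem_nhds (by simpa using ht)))
  filter_upwards [self_mem_nhdsWithin, hmem ν hν, hmem μ hμ,
    eventually_all.2 fun i => hmem _ (hsJ i)] with ε hε hνε hμε hsε
  have hε : 0 < ε := hε
  -- The averages are controlled only where the whole window [t, t + ε] lies in J; for small ε this
  -- set contains ν, μ and all the nodes.
  set J₁ : Set ℝ := J ∩ (fun t => t + ε) ⁻¹' J with hJ₁
  have hsub : ∀ t ∈ J₁, Icc t (t + ε) ⊆ J := fun t ht => hJ'.out ht.1 ht.2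
  have hst : ∀ t ∈ J₁, _root_.steklov f' ε t = (f (t + ε) - f t) / ε := fun t ht =>
    steklov_deriv hε.le (fun r hr => hf r (hsub t ht hr)) (hf'.mono (hsub t ht))
  refine (h.steklov hε.le hfc hf' hsub).sum_slopeQ_le
    (hJ.inter (hJ.preimage (by fun_prop))) (hJ'.inter (hJ'.preimage_mono
      (fun a b hab => add_le_add_left hab ε))) (g'' := fun t => (f' (t + ε) - f' t) / ε)
    (fun t ht => ?_) (fun t ht => hasDerivAt_steklov hJ hJ' hf' ht.1 ht.2) hs
    (fun i => ⟨hsJ i, hsε i⟩) ⟨hν, hνε⟩ ⟨hμ, hμε⟩ hνμ hsν hsμ x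
  rw [hst t ht]
  exact hasDerivAt_steklov hJ hJ' hfc ht.1 ht.2

/-- If the quadratic forms of `[s i, s j, 0]` are nonnegative, then so are those of
`[s i, s j, μ]` with `μ > 0`. -/
theorem LCPos.qPos {m : ℕ} {J : Set ℝ} (hJ : IsOpen J)
    (hJ0 : ∀ t ∈ J, 0 < t ∧ Ioc 0 t ⊆ J) {f f' : ℝ → ℝ} (hf : ∀ t ∈ J, HasDerivAt f (f' t) t)
    (hf' : ContinuousOn f' J) (hf0 : Tendsto f (𝓝[>] 0) (𝓝 (f 0))) (h : LCPos (m + 1) J f f')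
    (h0 : ∀ s : Fin m → ℝ, Function.Injective s → (∀ i, s i ∈ J) → ∀ x : Fin m → ℝ,
      0 ≤ ∑ i, ∑ j, x i * x j * slopeQ f f' (s i) (s j) 0) : QPos m J f f' := by
  intro s hs hsJ μ hμ hsμ x
  have hJ' : J.OrdConnected :=
    ⟨fun a ha b hb t ht => (hJ0 b hb).2 ⟨(hJ0 a ha).1.trans_le ht.1, ht.2⟩⟩
  have hD : ∀ s ∈ J, Tendsto (fun ν => (f s - f ν) / (s - ν)) (𝓝[>] 0)
      (𝓝 ((f s - f 0) / (s - 0))) := fun s hs => by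
    have : ContinuousAt (fun ν => s - ν) 0 := by fun_prop
    exact (hf0.const_sub _).div (this.tendsto.mono_left nhdsWithin_le_nhds)
      (by simpa using (hJ0 s hs).1.ne')
  have hlim : Tendsto (fun ν => ∑ i, ∑ j, x i * x j * slopeQ f f' (s i) (s j) ν) (𝓝[>] 0)
      (𝓝 (∑ i, ∑ j, x i * x j * slopeQ f f' (s i) (s j) 0)) := by
    refine tendsto_finsetSum _ fun i _ => tendsto_finsetSum _ fun j _ => Tendsto.const_mul _ ?_
    rcases eq_or_ne i j with rfl | hij
    · rw [slopeQ_self]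
      refine Tendsto.congr (fun ν => (slopeQ_self f f' (s i) ν).symm) ?_
      have : ContinuousAt (fun ν => s i - ν) 0 := by fun_prop
      exact ((hD _ (hsJ i)).const_sub _).div (this.tendsto.mono_left nhdsWithin_le_nhds)
        (by simpa using (hJ0 _ (hsJ i)).1.ne')
    · rw [slopeQ_of_ne _ _ _ (hs.ne hij)]
      refine Tendsto.congr (fun ν => (slopeQ_of_ne f f' ν (hs.ne hij)).symm) ?_
      exact ((hD _ (hsJ i)).sub (hD _ (hsJ j))).div_const _
  -- The base point 0 is not in J, so the comparison starts from ν > 0 below μ and all the nodes,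
  -- and then ν → 0.
  refine (h0 s hs hsJ x).trans (le_of_tendsto hlim ?_)
  have hlt : ∀ r, 0 < r → ∀ᶠ ν : ℝ in 𝓝[>] 0, ν < r := fun r hr =>
    nhdsWithin_le_nhds (Iio_mem_nhds hr)
  filter_upwards [self_mem_nhdsWithin, hlt μ (hJ0 μ hμ).1,
    eventually_all.2 fun i => hlt _ (hJ0 _ (hsJ i)).1] with ν hν hνμ hνs
  exact h.sum_slopeQ_le_of_continuousOn hJ hJ' hf hf' hs hsJ ((hJ0 μ hμ).2 ⟨hν, hνμ.le⟩) hμ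
    hνμ.le (fun i => (hνs i).ne') hsμ x

/-! ### Quadratic forms and norms of complex matrices. -/

/-- The real quadratic form of a complex matrix. -/
def qform {m : ℕ} (A : Matrix (Fin m) (Fin m) ℂ) (x : Fin m → ℂ) : ℝ := (star x ⬝ᵥ A *ᵥ x).re

/-- The squared Euclidean norm. -/
def sqNorm {m : ℕ} (x : Fin m → ℂ) : ℝ := ∑ i, normSq (x i)

/-- The squared Frobenius norm. -/
def sqFrob {m : ℕ} (A : Matrix (Fin m) (Fin m) ℂ) : ℝ := ∑ i, ∑ j, normSq (A i j)

section QuadraticForms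

variable {m : ℕ} (A B : Matrix (Fin m) (Fin m) ℂ) (x : Fin m → ℂ)

theorem sqNorm_nonneg : 0 ≤ sqNorm x := Finset.sum_nonneg fun _ _ => Complex.normSq_nonneg _

theorem sqFrob_nonneg : 0 ≤ sqFrob A :=
  Finset.sum_nonneg fun _ _ => Finset.sum_nonneg fun _ _ => Complex.normSq_nonneg _

theorem qform_add : qform (A + B) x = qform A x + qform B x := by
  simp [qform, Matrix.add_mulVec, dotProduct_add]

theorem qform_sub : qform (A - B) x = qform A x - qform B x := by
  simp [qform, Matrix.sub_mulVec, dotProduct_sub]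

theorem qform_smul (c : ℝ) : qform (c • A) x = c * qform A x := by
  simp [qform, Matrix.smul_mulVec, dotProduct_smul]

theorem qform_eq_sum : qform A x = ∑ i, ∑ j, (star (x i) * (A i j * x j)).re := by
  simp [qform, dotProduct, Matrix.mulVec, Finset.mul_sum]

theorem posSemidef_iff_qform : A.PosSemidef ↔ A.IsHermitian ∧ ∀ x, 0 ≤ qform A x := by
  rw [Matrix.posSemidef_iff_dotProduct_mulVec]
  refine and_congr_right fun h => forall_congr' fun x => ?_
  rw [Complex.nonneg_iff]
  exact and_iff_left (h.im_star_dotProduct_mulVec_self x).symm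

theorem qform_diagonal (d : Fin m → ℝ) :
    qform (Matrix.diagonal fun i => (d i : ℂ)) x = ∑ i, d i * normSq (x i) := by
  simp only [qform, dotProduct, Matrix.mulVec_diagonal, Complex.re_sum]
  refine Finset.sum_congr rfl fun i _ => ?_
  simp [Complex.normSq_apply]
  ring

theorem qform_one : qform 1 x = sqNorm x := by
  have := qform_diagonal x fun _ => 1
  simpa [sqNorm] using this

theorem qform_conj (U : Matrix (Fin m) (Fin m) ℂ) :
    qform (U * A * star U) x = qform A (star U *ᵥ x) := by
  rw [qform, qform, Matrix.star_mulVec, Matrix.star_eq_conjTranspose,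
    Matrix.conjTranspose_conjTranspose, ← Matrix.dotProduct_mulVec, Matrix.mulVec_mulVec,
    Matrix.mulVec_mulVec]

theorem sqNorm_star_mulVec {U : Matrix (Fin m) (Fin m) ℂ} (hU : U * star U = 1) :
    sqNorm (star U *ᵥ x) = sqNorm x := by
  rw [← qform_one, ← qform_conj, mul_one, hU, qform_one]

theorem sqFrob_eq_trace : sqFrob A = (Matrix.trace (star A * A)).re := by
  simp only [sqFrob, Matrix.trace, Matrix.diag, Matrix.mul_apply, Complex.re_sum]
  rw [Finset.sum_comm]
  refine Finset.sum_congr rfl fun i _ => Finset.sum_congr rfl fun j _ => ?_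
  simp [Complex.normSq_apply, Matrix.star_apply]

theorem sqFrob_unitary_mul {U : Matrix (Fin m) (Fin m) ℂ} (hU : star U * U = 1) :
    sqFrob (U * A) = sqFrob A := by
  rw [sqFrob_eq_trace, sqFrob_eq_trace, star_mul, mul_assoc, ← mul_assoc (star U), hU, one_mul]

theorem sqFrob_mul_unitary {U : Matrix (Fin m) (Fin m) ℂ} (hU : U * star U = 1) :
    sqFrob (A * U) = sqFrob A := by
  rw [sqFrob_eq_trace, sqFrob_eq_trace, star_mul, Matrix.trace_mul_comm, mul_assoc,
    ← mul_assoc U, hU, one_mul, Matrix.trace_mul_comm]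

end QuadraticForms

/-! ### Diagonalization, functional calculus and perturbation bounds. -/

section Spectral

variable {m : ℕ} {A B : Matrix (Fin m) (Fin m) ℂ}

/-- Unitary diagonalization, together with the functional calculus. -/
theorem Matrix.IsHermitian.exists_diagonalization (hA : A.IsHermitian) :
    ∃ (U : Matrix (Fin m) (Fin m) ℂ) (d : Fin m → ℝ), star U * U = 1 ∧ U * star U = 1 ∧
      spectrum ℝ A = range d ∧
      (∀ f : ℝ → ℝ, cfc f A = U * Matrix.diagonal (fun i => (f (d i) : ℂ)) * star U) ∧
      A = U * Matrix.diagonal (fun i => (d i : ℂ)) * star U := by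
  refine ⟨hA.eigenvectorUnitary, hA.eigenvalues, Unitary.coe_star_mul_self _,
    Unitary.coe_mul_star_self _, hA.spectrum_real_eq_range_eigenvalues, fun f => ?_, ?_⟩
  · rw [hA.cfc_eq]
    rfl
  · conv_lhs => rw [hA.spectral_theorem]
    rfl

/-- The vector y, the coordinates of x in an eigenbasis, does not depend on f; comparing f(A) and
g(A) thus becomes comparing scalars at the eigenvalues. -/
theorem Matrix.IsHermitian.exists_qform_cfc (hA : A.IsHermitian) :
    ∃ d : Fin m → ℝ, spectrum ℝ A = range d ∧ ∀ x, ∃ y, sqNorm y = sqNorm x ∧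
      (∀ f : ℝ → ℝ, qform (cfc f A) x = ∑ i, f (d i) * normSq (y i)) ∧
      qform A x = ∑ i, d i * normSq (y i) := by
  obtain ⟨U, d, -, hU, hd, hf, hAd⟩ := hA.exists_diagonalization
  refine ⟨d, hd, fun x => ⟨star U *ᵥ x, sqNorm_star_mulVec x hU, fun f => ?_, ?_⟩⟩
  · rw [hf, qform_conj, qform_diagonal]
  · conv_lhs => rw [hAd]
    rw [qform_conj, qform_diagonal]

/-- Quadratic forms are linear in the matrix, so this form of the spectral condition passes at once
to convex combinations and perturbations. -/
theorem spectrum_subset_Icc_iff (hA : A.IsHermitian) (a b : ℝ) :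
    spectrum ℝ A ⊆ Icc a b ↔ ∀ x, a * sqNorm x ≤ qform A x ∧ qform A x ≤ b * sqNorm x := by
  constructor
  · intro h x
    obtain ⟨d, hd, hx⟩ := hA.exists_qform_cfc
    obtain ⟨y, hy, -, hq⟩ := hx x
    rw [hd] at h
    rw [hq, ← hy, sqNorm, Finset.mul_sum, Finset.mul_sum]
    exact ⟨Finset.sum_le_sum fun i _ =>
        mul_le_mul_of_nonneg_right (h ⟨i, rfl⟩).1 (Complex.normSq_nonneg _),
      Finset.sum_le_sum fun i _ =>
        mul_le_mul_of_nonneg_right (h ⟨i, rfl⟩).2 (Complex.normSq_nonneg _)⟩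
  · intro h
    obtain ⟨U, d, hU, hU', hd, -, hAd⟩ := hA.exists_diagonalization
    rw [hd]
    rintro _ ⟨i, rfl⟩
    have hy : star U *ᵥ (U *ᵥ Pi.single i 1) = Pi.single i 1 := by
      rw [Matrix.mulVec_mulVec, hU, Matrix.one_mulVec]
    have h1 : sqNorm (U *ᵥ Pi.single i 1) = 1 := by
      rw [← sqNorm_star_mulVec _ hU', hy, sqNorm, Finset.sum_eq_single i] <;>
        simp +contextual
    have h2 : qform A (U *ᵥ Pi.single i 1) = d i := by
      rw [hAd, qform_conj, qform_diagonal, hy, Finset.sum_eq_single i] <;>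
        simp +contextual
    have h3 := h (U *ᵥ Pi.single i 1)
    rwa [h1, h2, mul_one, mul_one] at h3

theorem abs_qform_cfc_sub_le (hA : A.IsHermitian) {S : Set ℝ} (hS : spectrum ℝ A ⊆ S)
    {f g : ℝ → ℝ} {δ : ℝ} (h : ∀ t ∈ S, |f t - g t| ≤ δ) (x : Fin m → ℂ) :
    |qform (cfc f A) x - qform (cfc g A) x| ≤ δ * sqNorm x := by
  obtain ⟨d, hd, hx⟩ := hA.exists_qform_cfc
  obtain ⟨y, hy, hf, -⟩ := hx x
  rw [hf, hf, ← hy, ← Finset.sum_sub_distrib, sqNorm, Finset.mul_sum]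
  refine (Finset.abs_sum_le_sum_abs _ _).trans (Finset.sum_le_sum fun i _ => ?_)
  rw [← sub_mul, abs_mul, abs_of_nonneg (Complex.normSq_nonneg _)]
  exact mul_le_mul_of_nonneg_right (h _ (hS (hd ▸ ⟨i, rfl⟩))) (Complex.normSq_nonneg _)

theorem tendsto_qform_cfc {ι : Type*} {l : Filter ι} {F : ι → ℝ → ℝ} {f : ℝ → ℝ}
    (hA : A.IsHermitian) (h : ∀ t ∈ spectrum ℝ A, Tendsto (fun k => F k t) l (𝓝 (f t)))
    (x : Fin m → ℂ) : Tendsto (fun k => qform (cfc (F k) A) x) l (𝓝 (qform (cfc f A) x)) := by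
  obtain ⟨d, hd, hx⟩ := hA.exists_qform_cfc
  obtain ⟨y, hy, hf, -⟩ := hx x
  simp only [hf]
  exact tendsto_finsetSum _ fun i _ => (h _ (hd ▸ ⟨i, rfl⟩)).mul_const _

/-- A Lipschitz function is operator Lipschitz for the Frobenius norm. -/
theorem sqFrob_cfc_sub_le (hA : A.IsHermitian) (hB : B.IsHermitian) {S : Set ℝ}
    (hAS : spectrum ℝ A ⊆ S) (hBS : spectrum ℝ B ⊆ S) {r : ℝ → ℝ} {δ : ℝ}
    (h : ∀ u ∈ S, ∀ v ∈ S, |r u - r v| ≤ δ * |u - v|) :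
    sqFrob (cfc r B - cfc r A) ≤ δ ^ 2 * sqFrob (B - A) := by
  obtain ⟨U, d, hU, hU', hd, hf, hAd⟩ := hA.exists_diagonalization
  obtain ⟨V, e, hV, hV', he, hg, hBe⟩ := hB.exists_diagonalization
  -- Between the two eigenbases, a difference of functions of B and A has entries (φ_j - ψ_i) W_ij
  -- with W = U*V. The same W serves for r and for the identity, so the scalar Lipschitz bound
  -- applies entry by entry.
  have key : ∀ φ ψ : Fin m → ℝ, sqFrob (V * Matrix.diagonal (fun i => (φ i : ℂ)) * star V
      - U * Matrix.diagonal (fun i => (ψ i : ℂ)) * star U) =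
      ∑ i, ∑ j, (φ j - ψ i) ^ 2 * normSq ((star U * V) i j) := by
    intro φ ψ
    rw [← sqFrob_mul_unitary _ hV', ← sqFrob_unitary_mul (U := star U) _ (by simpa using hU')]
    have e : star U * ((V * Matrix.diagonal (fun i => (φ i : ℂ)) * star V
      - U * Matrix.diagonal (fun i => (ψ i : ℂ)) * star U) * V) =
        star U * V * Matrix.diagonal (fun i => (φ i : ℂ))
          - Matrix.diagonal (fun i => (ψ i : ℂ)) * (star U * V) := by
      calc _ = star U * V * Matrix.diagonal (fun i => (φ i : ℂ)) * (star V * V)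
          - (star U * U) * Matrix.diagonal (fun i => (ψ i : ℂ)) * (star U * V) := by noncomm_ring
        _ = _ := by rw [hU, hV, mul_one, one_mul]
    rw [e]
    refine Finset.sum_congr rfl fun i _ => Finset.sum_congr rfl fun j _ => ?_
    rw [Matrix.sub_apply, Matrix.mul_diagonal, Matrix.diagonal_mul, mul_comm, ← sub_mul,
      Complex.normSq_mul, ← Complex.ofReal_sub, Complex.normSq_ofReal, sq]
  rw [hf, hg, key]
  conv_rhs => rw [hAd, hBe, key]
  rw [Finset.mul_sum]
  refine Finset.sum_le_sum fun i _ => ?_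
  rw [Finset.mul_sum]
  refine Finset.sum_le_sum fun j _ => ?_
  rw [← mul_assoc]
  refine mul_le_mul_of_nonneg_right ?_ (Complex.normSq_nonneg _)
  have := pow_le_pow_left₀ (abs_nonneg _)
    (h _ (hBS (he ▸ mem_range_self j)) _ (hAS (hd ▸ mem_range_self i))) 2
  rwa [sq_abs, mul_pow, sq_abs] at this

theorem abs_qform_le_of_sqFrob_le {c : ℝ} (hc : 0 ≤ c) (h : sqFrob A ≤ c ^ 2) (x : Fin m → ℂ) :
    |qform A x| ≤ c * (∑ i, ‖x i‖) ^ 2 := by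
  have hent : ∀ i j, ‖A i j‖ ≤ c := by
    intro i j
    have h1 : normSq (A i j) ≤ sqFrob A :=
      (Finset.single_le_sum (f := fun j => normSq (A i j))
        (fun _ _ => Complex.normSq_nonneg _) (Finset.mem_univ j)).trans
        (Finset.single_le_sum (f := fun i => ∑ j, normSq (A i j))
          (fun _ _ => Finset.sum_nonneg fun _ _ => Complex.normSq_nonneg _) (Finset.mem_univ i))
    rw [Complex.normSq_eq_norm_sq] at h1
    exact (sq_le_sq₀ (norm_nonneg _) hc).1 (h1.trans h)
  rw [qform_eq_sum, sq, Finset.sum_mul_sum, Finset.mul_sum]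
  refine (Finset.abs_sum_le_sum_abs _ _).trans (Finset.sum_le_sum fun i _ => ?_)
  rw [Finset.mul_sum]
  refine (Finset.abs_sum_le_sum_abs _ _).trans (Finset.sum_le_sum fun j _ => ?_)
  refine (Complex.abs_re_le_norm _).trans ?_
  rw [norm_mul, norm_mul, norm_star]
  calc ‖x i‖ * (‖A i j‖ * ‖x j‖) ≤ ‖x i‖ * (c * ‖x j‖) := by gcongr; exact hent i j
    _ = c * (‖x i‖ * ‖x j‖) := by ring

end Spectral

/-! ### Noncommutative derivatives and divided differences of polynomials. -/

section PolynomialCalculus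

/-- The derivative of the `N`-th power at `X` in the direction `H`. -/
def powD {R : Type*} [Ring R] (X H : R) : ℕ → R
  | 0 => 0
  | N + 1 => powD X H N * X + X ^ N * H

/-- Half the second derivative of the `N`-th power at `X` in the direction `H`. -/
def powD₂ {R : Type*} [Ring R] (X H : R) : ℕ → R
  | 0 => 0
  | N + 1 => powD₂ X H N * X + powD X H N * H

/-- The first divided difference of the `N`-th power. -/
def powL (s t : ℝ) : ℕ → ℝ
  | 0 => 0
  | N + 1 => powL s t N * t + s ^ N

/-- The second divided difference of the `N`-th power. -/
def powQ (s u t : ℝ) : ℕ → ℝ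
  | 0 => 0
  | N + 1 => powQ s u t N * t + powL s u N

theorem powL_mul_sub (s t : ℝ) (N : ℕ) : (s - t) * powL s t N = s ^ N - t ^ N := by
  induction N with
  | zero => simp [powL]
  | succ N ih => rw [powL, mul_add, ← mul_assoc, ih]; ring

theorem powL_self (s : ℝ) (N : ℕ) : powL s s N = N * s ^ (N - 1) := by
  induction N with
  | zero => simp [powL]
  | succ N ih =>
    rw [powL, ih]
    rcases N with _ | N
    · simp
    · simp only [Nat.add_sub_cancel]; push_cast; ring

theorem powQ_mul_sub (s u t : ℝ) (N : ℕ) :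
    (u - t) * powQ s u t N = powL s u N - powL s t N := by
  induction N with
  | zero => simp [powL, powQ]
  | succ N ih =>
    rw [powQ, mul_add, ← mul_assoc, ih, powL, powL]
    ring

variable {m : ℕ}

theorem mul_mul_pow_of_mul_eq_one {U X V : Matrix (Fin m) (Fin m) ℂ} (h : V * U = 1) (h' : U * V = 1) (N : ℕ) :
    (U * X * V) ^ N = U * X ^ N * V := by
  induction N with
  | zero => simp [h']
  | succ N ih =>
    rw [pow_succ, ih, pow_succ]
    calc _ = U * X ^ N * (V * U) * X * V := by noncomm_ring
      _ = _ := by rw [h]; noncomm_ring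

theorem powD_conj {U X H V : Matrix (Fin m) (Fin m) ℂ} (h : V * U = 1) (h' : U * V = 1) (N : ℕ) :
    powD (U * X * V) (U * H * V) N = U * powD X H N * V := by
  induction N with
  | zero => simp [powD]
  | succ N ih =>
    rw [powD, ih, mul_mul_pow_of_mul_eq_one h h', powD]
    calc _ = U * powD X H N * (V * U) * X * V + U * X ^ N * (V * U) * H * V := by noncomm_ring
      _ = _ := by rw [h]; noncomm_ring

theorem powD₂_conj {U X H V : Matrix (Fin m) (Fin m) ℂ} (h : V * U = 1) (h' : U * V = 1)
    (N : ℕ) : powD₂ (U * X * V) (U * H * V) N = U * powD₂ X H N * V := by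
  induction N with
  | zero => simp [powD₂]
  | succ N ih =>
    rw [powD₂, ih, powD_conj h h', powD₂]
    calc _ = U * powD₂ X H N * (V * U) * X * V + U * powD X H N * (V * U) * H * V := by
          noncomm_ring
      _ = _ := by rw [h]; noncomm_ring

theorem powD_diagonal (a : Fin m → ℝ) (K : Matrix (Fin m) (Fin m) ℂ) (N : ℕ) (i j : Fin m) :
    powD (Matrix.diagonal fun i => (a i : ℂ)) K N i j = powL (a i) (a j) N * K i j := by
  induction N with
  | zero => simp [powD, powL]
  | succ N ih =>
    rw [powD, Matrix.add_apply, Matrix.mul_diagonal, ih, Matrix.diagonal_pow, Matrix.diagonal_mul,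
      powL]
    simp only [Pi.pow_apply]
    push_cast
    ring

theorem powD₂_diagonal (a : Fin m → ℝ) (K : Matrix (Fin m) (Fin m) ℂ) (N : ℕ) (i j : Fin m) :
    powD₂ (Matrix.diagonal fun i => (a i : ℂ)) K N i j =
      ∑ k, powQ (a i) (a k) (a j) N * (K i k * K k j) := by
  induction N with
  | zero => simp [powD₂, powQ]
  | succ N ih =>
    rw [powD₂, Matrix.add_apply, Matrix.mul_diagonal, ih, Matrix.mul_apply, Finset.sum_mul,
      ← Finset.sum_add_distrib]
    refine Finset.sum_congr rfl fun k _ => ?_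
    rw [powD_diagonal, powQ]
    push_cast
    ring

open Polynomial

/-- The derivative of `p` at the matrix `X` in the direction `H`. -/
noncomputable def polyD (p : ℝ[X]) (X H : Matrix (Fin m) (Fin m) ℂ) : Matrix (Fin m) (Fin m) ℂ :=
  ∑ N ∈ Finset.range (p.natDegree + 1), p.coeff N • powD X H N

/-- Half the second derivative of `p` at the matrix `X` in the direction `H`. -/
noncomputable def polyD₂ (p : ℝ[X]) (X H : Matrix (Fin m) (Fin m) ℂ) :
    Matrix (Fin m) (Fin m) ℂ :=
  ∑ N ∈ Finset.range (p.natDegree + 1), p.coeff N • powD₂ X H N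

/-- The first divided difference of a polynomial. -/
noncomputable def polyL (p : ℝ[X]) (s t : ℝ) : ℝ :=
  ∑ N ∈ Finset.range (p.natDegree + 1), p.coeff N * powL s t N

/-- The second divided difference of a polynomial. -/
noncomputable def polyQ (p : ℝ[X]) (s u t : ℝ) : ℝ :=
  ∑ N ∈ Finset.range (p.natDegree + 1), p.coeff N * powQ s u t N

theorem polyL_eq (p : ℝ[X]) (s t : ℝ) :
    polyL p s t = slopeL (fun r => p.eval r) (fun r => p.derivative.eval r) s t := by
  rcases eq_or_ne s t with rfl | h
  · rw [slopeL_self, polyL, derivative_eval, sum_over_range _ (by simp)]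
    exact Finset.sum_congr rfl fun N _ => by rw [powL_self]; ring
  · rw [slopeL_of_ne _ _ h, eq_div_iff (sub_ne_zero.2 h), polyL, eval_eq_sum_range,
      eval_eq_sum_range, ← Finset.sum_sub_distrib, Finset.sum_mul]
    refine Finset.sum_congr rfl fun N _ => ?_
    linear_combination p.coeff N * powL_mul_sub s t N

theorem polyQ_mul_sub (p : ℝ[X]) (s u t : ℝ) :
    (u - t) * polyQ p s u t = polyL p s u - polyL p s t := by
  rw [polyQ, polyL, polyL, ← Finset.sum_sub_distrib, Finset.mul_sum]
  refine Finset.sum_congr rfl fun N _ => ?_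
  linear_combination p.coeff N * powQ_mul_sub s u t N

/-- The middle argument u of `polyQ` plays the role of the base point μ of `slopeQ`. The recursion
for `polyQ` has no denominators, so it continues `slopeQ` to coinciding nodes. -/
theorem polyQ_eq (p : ℝ[X]) {s t u : ℝ} (hs : s ≠ u) (ht : t ≠ u) :
    polyQ p s u t = slopeQ (fun r => p.eval r) (fun r => p.derivative.eval r) s t u := by
  have h1 : u - t ≠ 0 := sub_ne_zero.2 ht.symm
  have h2 : s - u ≠ 0 := sub_ne_zero.2 hs
  have h3 : t - u ≠ 0 := sub_ne_zero.2 ht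
  have key := polyQ_mul_sub p s u t
  rw [polyL_eq, polyL_eq, slopeL_of_ne _ _ hs] at key
  rw [← mul_right_inj' h1, key]
  rcases eq_or_ne s t with rfl | h
  · rw [slopeL_self, slopeQ_self, show u - s = -(s - u) by ring]
    field_simp
    ring
  · rw [slopeL_of_ne _ _ h, slopeQ_of_ne _ _ _ h, show u - t = -(t - u) by ring]
    have : s - t ≠ 0 := sub_ne_zero.2 h
    field_simp
    ring

theorem continuous_powL : ∀ N, Continuous fun v : ℝ × ℝ × ℝ => powL v.1 v.2.1 N
  | 0 => continuous_const
  | N + 1 => ((continuous_powL N).mul (by fun_prop)).add (by fun_prop)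

theorem continuous_powQ : ∀ N, Continuous fun v : ℝ × ℝ × ℝ => powQ v.1 v.2.1 v.2.2 N
  | 0 => continuous_const
  | N + 1 => ((continuous_powQ N).mul (by fun_prop)).add (continuous_powL N)

theorem continuous_polyQ (p : ℝ[X]) : Continuous fun v : ℝ × ℝ × ℝ => polyQ p v.1 v.2.1 v.2.2 :=
  continuous_finsetSum _ fun N _ => continuous_const.mul (continuous_powQ N)

theorem polyD_diagonal (p : ℝ[X]) (a : Fin m → ℝ) (K : Matrix (Fin m) (Fin m) ℂ)
    (i j : Fin m) :
    polyD p (Matrix.diagonal fun i => (a i : ℂ)) K i j = polyL p (a i) (a j) * K i j := by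
  simp only [polyD, Matrix.sum_apply, Matrix.smul_apply, powD_diagonal, polyL]
  push_cast
  rw [Finset.sum_mul]
  exact Finset.sum_congr rfl fun N _ => by rw [Complex.real_smul]; ring

theorem polyD₂_diagonal (p : ℝ[X]) (a : Fin m → ℝ) (K : Matrix (Fin m) (Fin m) ℂ)
    (i j : Fin m) :
    polyD₂ p (Matrix.diagonal fun i => (a i : ℂ)) K i j =
      ∑ k, polyQ p (a i) (a k) (a j) * (K i k * K k j) := by
  simp only [polyD₂, Matrix.sum_apply, Matrix.smul_apply, powD₂_diagonal, polyQ, Finset.smul_sum]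
  push_cast
  rw [Finset.sum_comm]
  refine Finset.sum_congr rfl fun k _ => ?_
  rw [Finset.sum_mul]
  exact Finset.sum_congr rfl fun N _ => by rw [Complex.real_smul]; ring

theorem polyD₂_conj (p : ℝ[X]) {U X H V : Matrix (Fin m) (Fin m) ℂ} (h : V * U = 1)
    (h' : U * V = 1) : polyD₂ p (U * X * V) (U * H * V) = U * polyD₂ p X H * V := by
  simp only [polyD₂, powD₂_conj h h', Finset.mul_sum, Finset.sum_mul, mul_smul_comm,
    smul_mul_assoc]

end PolynomialCalculus

/-! ### Derivatives of matrix polynomials along lines. -/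

section MatrixDerivative

open Polynomial

variable {m : ℕ} {F G : ℝ → Matrix (Fin m) (Fin m) ℂ} {F' G' : Matrix (Fin m) (Fin m) ℂ} {t : ℝ}

/-- Entrywise derivative of a matrix-valued function. -/
def HasEntryDeriv (F : ℝ → Matrix (Fin m) (Fin m) ℂ) (F' : Matrix (Fin m) (Fin m) ℂ) (t : ℝ) :
    Prop :=
  ∀ i j, HasDerivAt (fun t => F t i j) (F' i j) t

theorem HasEntryDeriv.mul (hF : HasEntryDeriv F F' t) (hG : HasEntryDeriv G G' t) :
    HasEntryDeriv (fun t => F t * G t) (F' * G t + F t * G') t := by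
  intro i j
  simp only [Matrix.mul_apply, Matrix.add_apply, ← Finset.sum_add_distrib]
  exact HasDerivAt.fun_sum fun k _ => (hF i k).mul (hG k j)

theorem HasEntryDeriv.add (hF : HasEntryDeriv F F' t) (hG : HasEntryDeriv G G' t) :
    HasEntryDeriv (fun t => F t + G t) (F' + G') t :=
  fun i j => (hF i j).add (hG i j)

theorem HasEntryDeriv.sum_smul {ι : Type*} {S : Finset ι} {c : ι → ℝ}
    {F : ι → ℝ → Matrix (Fin m) (Fin m) ℂ} {F' : ι → Matrix (Fin m) (Fin m) ℂ}
    (h : ∀ k, HasEntryDeriv (F k) (F' k) t) :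
    HasEntryDeriv (fun t => ∑ k ∈ S, c k • F k t) (∑ k ∈ S, c k • F' k) t := by
  intro i j
  simp only [Matrix.sum_apply, Matrix.smul_apply]
  exact HasDerivAt.fun_sum fun k _ => (h k i j).const_smul (c k)

theorem HasEntryDeriv.qform (hF : HasEntryDeriv F F' t) (x : Fin m → ℂ) :
    HasDerivAt (fun t => qform (F t) x) (qform F' x) t := by
  simp only [qform_eq_sum]
  refine HasDerivAt.fun_sum fun i _ => HasDerivAt.fun_sum fun j _ => ?_
  exact Complex.reCLM.hasFDerivAt.comp_hasDerivAt t (((hF i j).mul_const (x j)).const_mul _)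

variable (A H : Matrix (Fin m) (Fin m) ℂ)

theorem hasEntryDeriv_line : HasEntryDeriv (fun t => A + t • H) H t := by
  intro i j
  simp only [Matrix.add_apply, Matrix.smul_apply]
  simpa using ((hasDerivAt_id' t).smul_const (H i j)).const_add (A i j)

theorem hasEntryDeriv_const (C : Matrix (Fin m) (Fin m) ℂ) : HasEntryDeriv (fun _ => C) 0 t :=
  fun _ _ => hasDerivAt_const _ _

theorem hasEntryDeriv_pow (N : ℕ) :
    HasEntryDeriv (fun t => (A + t • H) ^ N) (powD (A + t • H) H N) t := by
  induction N with
  | zero => simpa [powD] using hasEntryDeriv_const 1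
  | succ N ih =>
    simp only [pow_succ]
    exact ih.mul (hasEntryDeriv_line A H)

theorem hasEntryDeriv_powD (N : ℕ) :
    HasEntryDeriv (fun t => powD (A + t • H) H N) (2 • powD₂ (A + t • H) H N) t := by
  induction N with
  | zero => simpa [powD, powD₂] using hasEntryDeriv_const 0
  | succ N ih =>
    have h := (ih.mul (hasEntryDeriv_line A H)).add
      ((hasEntryDeriv_pow A H N).mul (hasEntryDeriv_const H))
    have e : 2 • powD₂ (A + t • H) H (N + 1) = 2 • powD₂ (A + t • H) H N * (A + t • H)
        + powD (A + t • H) H N * H + (powD (A + t • H) H N * H + (A + t • H) ^ N * 0) := by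
      rw [powD₂, mul_zero, add_zero, two_smul, two_smul, add_mul]
      abel
    rw [e]
    exact h

theorem hasDerivAt_qform_aeval (p : ℝ[X]) (x : Fin m → ℂ) (t : ℝ) :
    HasDerivAt (fun t => qform (aeval (A + t • H) p) x) (qform (polyD p (A + t • H) H) x) t := by
  simp only [aeval_eq_sum_range]
  exact (HasEntryDeriv.sum_smul fun N => hasEntryDeriv_pow A H N).qform x

theorem hasDerivAt_qform_polyD (p : ℝ[X]) (x : Fin m → ℂ) (t : ℝ) :
    HasDerivAt (fun t => qform (polyD p (A + t • H) H) x)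
      (2 * qform (polyD₂ p (A + t • H) H) x) t := by
  have h : HasEntryDeriv (fun t => polyD p (A + t • H) H)
      (∑ N ∈ Finset.range (p.natDegree + 1), p.coeff N • (2 • powD₂ (A + t • H) H N)) t :=
    HasEntryDeriv.sum_smul fun N => hasEntryDeriv_powD A H N
  refine (h.qform x).congr_deriv ?_
  rw [← qform_smul, polyD₂, Finset.smul_sum]
  congr 1
  refine Finset.sum_congr rfl fun N _ => ?_
  rw [smul_comm, ← Nat.cast_smul_eq_nsmul ℝ]
  simp

end MatrixDerivative

/-! ### Polynomial approximation together with derivatives. -/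

section PolynomialApproximation

open Polynomial

theorem Polynomial.exists_derivative_eq (P : ℝ[X]) : ∃ p : ℝ[X], derivative p = P := by
  refine ⟨∑ N ∈ Finset.range (P.natDegree + 1), C (P.coeff N / (N + 1)) * X ^ (N + 1), ?_⟩
  conv_rhs => rw [P.as_sum_range_C_mul_X_pow]
  rw [derivative_sum]
  refine Finset.sum_congr rfl fun N _ => ?_
  rw [derivative_C_mul_X_pow, Nat.add_sub_cancel]
  congr 2
  push_cast
  field_simp

/-- Primitives of close functions can be chosen close. -/
theorem exists_primitive_near {a b : ℝ} (hab : a ≤ b) {g g' : ℝ → ℝ}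
    (hg : ∀ t ∈ Icc a b, HasDerivAt g (g' t) t) {δ : ℝ} {P : ℝ[X]}
    (hP : ∀ t ∈ Icc a b, |P.eval t - g' t| ≤ δ) :
    ∃ p : ℝ[X], derivative p = P ∧ ∀ t ∈ Icc a b, |p.eval t - g t| ≤ δ * (b - a) := by
  obtain ⟨p, hp⟩ := P.exists_derivative_eq
  refine ⟨p + C (g a - p.eval a), by simp [hp], fun t ht => ?_⟩
  have hδ : 0 ≤ δ := (abs_nonneg _).trans (hP a ⟨le_rfl, hab⟩)
  have h := Convex.norm_image_sub_le_of_norm_hasDerivWithin_le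
    (f := fun t => p.eval t - g t) (f' := fun t => P.eval t - g' t) (s := Icc a b)
    (fun x hx => by
      have := (p.hasDerivAt x).fun_sub (hg x hx)
      rw [hp] at this
      exact this.hasDerivWithinAt) hP (convex_Icc a b) ⟨le_rfl, hab⟩ ht
  rw [Real.norm_eq_abs, Real.norm_eq_abs, abs_of_nonneg (sub_nonneg.2 ht.1)] at h
  rw [eval_add, eval_C]
  calc _ = |p.eval t - g t - (p.eval a - g a)| := by congr 1; ring
    _ ≤ δ * (t - a) := h
    _ ≤ δ * (b - a) := by gcongr; exact ht.2

/-- Polynomial approximation in `C¹`. -/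
theorem exists_polynomial_near_C1 {a b : ℝ} (hab : a ≤ b) {g g' : ℝ → ℝ}
    (hg : ∀ t ∈ Icc a b, HasDerivAt g (g' t) t) (hg' : ContinuousOn g' (Icc a b))
    {δ : ℝ} (hδ : 0 < δ) :
    ∃ p : ℝ[X], (∀ t ∈ Icc a b, |p.eval t - g t| ≤ δ * (b - a)) ∧
      ∀ t ∈ Icc a b, |p.derivative.eval t - g' t| ≤ δ := by
  obtain ⟨P, hP⟩ := exists_polynomial_near_of_continuousOn a b g' hg' δ hδ
  obtain ⟨p, rfl, hp⟩ := exists_primitive_near hab hg fun t ht => (hP t ht).le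
  exact ⟨p, hp, fun t ht => (hP t ht).le⟩

/-- Polynomial approximation in `C²`. -/
theorem exists_polynomial_near_C2 {a b : ℝ} (hab : a ≤ b) {g g' g'' : ℝ → ℝ}
    (hg : ∀ t ∈ Icc a b, HasDerivAt g (g' t) t) (hg' : ∀ t ∈ Icc a b, HasDerivAt g' (g'' t) t)
    (hg'' : ContinuousOn g'' (Icc a b)) {δ : ℝ} (hδ : 0 < δ) :
    ∃ p : ℝ[X], (∀ t ∈ Icc a b, |p.eval t - g t| ≤ δ * (b - a) * (b - a)) ∧
      ∀ t ∈ Icc a b, |p.derivative.derivative.eval t - g'' t| ≤ δ := by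
  obtain ⟨P, hP, hP'⟩ := exists_polynomial_near_C1 hab hg' hg'' hδ
  obtain ⟨p, rfl, hp⟩ := exists_primitive_near hab hg hP
  exact ⟨p, hp, hP'⟩

end PolynomialApproximation

/-! ### Bounds for divided differences by derivatives. -/

section DividedDifferenceBounds

theorem abs_slopeL_le {a b : ℝ} {r r' : ℝ → ℝ} (hr : ∀ t ∈ Icc a b, HasDerivAt r (r' t) t)
    {δ : ℝ} (hδ : ∀ t ∈ Icc a b, |r' t| ≤ δ) {s t : ℝ} (hs : s ∈ Icc a b) (ht : t ∈ Icc a b) :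
    |slopeL r r' s t| ≤ δ := by
  rcases eq_or_ne s t with rfl | h
  · rw [slopeL_self]
    exact hδ s hs
  · rw [slopeL_of_ne _ _ h, abs_div, div_le_iff₀ (abs_pos.2 (sub_ne_zero.2 h))]
    exact Convex.norm_image_sub_le_of_norm_hasDerivWithin_le
      (fun x hx => (hr x hx).hasDerivWithinAt) hδ (convex_Icc a b) ht hs

/-- The difference quotient with base μ is the mean of r' on the segment from μ, realized as an
increment in θ ∈ [0, 1]. The Lipschitz bound for r' is then inserted through the mean value
inequality; the sharp factor 1/2 is not needed. -/
theorem abs_slopeQ_le {a b : ℝ} {r r' r'' : ℝ → ℝ} (hr : ∀ t ∈ Icc a b, HasDerivAt r (r' t) t)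
    (hr' : ∀ t ∈ Icc a b, HasDerivAt r' (r'' t) t) {δ : ℝ} (hδ : ∀ t ∈ Icc a b, |r'' t| ≤ δ)
    {s t μ : ℝ} (hs : s ∈ Icc a b) (ht : t ∈ Icc a b) (hμ : μ ∈ Icc a b) (hsμ : s ≠ μ)
    (htμ : t ≠ μ) : |slopeQ r r' s t μ| ≤ δ := by
  have hδ0 : 0 ≤ δ := (abs_nonneg _).trans (hδ s hs)
  have hseg : ∀ y ∈ Icc a b, ∀ θ ∈ Icc (0 : ℝ) 1, μ + θ * (y - μ) ∈ Icc a b := by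
    intro y hy θ hθ
    have := (convex_Icc a b) hμ hy (sub_nonneg.2 hθ.2) hθ.1 (by ring)
    simp only [smul_eq_mul] at this
    convert this using 1
    ring
  have hlip : ∀ u ∈ Icc a b, ∀ v ∈ Icc a b, |r' u - r' v| ≤ δ * |u - v| := fun u hu v hv =>
    Convex.norm_image_sub_le_of_norm_hasDerivWithin_le
      (fun x hx => (hr' x hx).hasDerivWithinAt) hδ (convex_Icc a b) hv hu
  have hder : ∀ y ∈ Icc a b, y ≠ μ → ∀ θ ∈ Icc (0 : ℝ) 1,
      HasDerivAt (fun θ => r (μ + θ * (y - μ)) / (y - μ)) (r' (μ + θ * (y - μ))) θ := by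
    intro y hy hyμ θ hθ
    have h1 : HasDerivAt (fun θ : ℝ => μ + θ * (y - μ)) (y - μ) θ := by
      simpa using ((hasDerivAt_id' θ).mul_const (y - μ)).const_add μ
    refine (((hr _ (hseg y hy θ hθ)).comp θ h1).div_const (y - μ)).congr_deriv ?_
    rw [mul_div_assoc, div_self (sub_ne_zero.2 hyμ), mul_one]
  rcases eq_or_ne s t with rfl | h
  · have hb := norm_image_sub_le_of_norm_deriv_le_segment_01' (C := δ * |s - μ|)
      (f := fun θ => θ * r' s - r (μ + θ * (s - μ)) / (s - μ))
      (f' := fun θ => r' s - r' (μ + θ * (s - μ))) (fun θ hθ => by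
        have := ((hasDerivAt_id' θ).mul_const (r' s)).fun_sub (hder s hs hsμ θ hθ)
        rw [one_mul] at this
        exact this.hasDerivWithinAt) (fun θ hθ => by
        refine (hlip s hs _ (hseg s hs θ ⟨hθ.1, hθ.2.le⟩)).trans ?_
        refine mul_le_mul_of_nonneg_left ?_ hδ0
        rw [show s - (μ + θ * (s - μ)) = (1 - θ) * (s - μ) by ring, abs_mul,
          abs_of_nonneg (sub_nonneg.2 hθ.2.le)]
        exact mul_le_of_le_one_left (abs_nonneg _) (by linarith [hθ.1]))
    rw [slopeQ_self, abs_div, div_le_iff₀ (abs_pos.2 (sub_ne_zero.2 hsμ))]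
    refine le_of_eq_of_le ?_ hb
    rw [Real.norm_eq_abs]
    congr 1
    simp only [one_mul, zero_mul, add_zero, add_sub_cancel]
    ring
  · have hb := norm_image_sub_le_of_norm_deriv_le_segment_01' (C := δ * |s - t|)
      (f := fun θ => r (μ + θ * (s - μ)) / (s - μ) - r (μ + θ * (t - μ)) / (t - μ))
      (f' := fun θ => r' (μ + θ * (s - μ)) - r' (μ + θ * (t - μ)))
      (fun θ hθ => ((hder s hs hsμ θ hθ).fun_sub (hder t ht htμ θ hθ)).hasDerivWithinAt)
      (fun θ hθ => by
        refine (hlip _ (hseg s hs θ ⟨hθ.1, hθ.2.le⟩) _ (hseg t ht θ ⟨hθ.1, hθ.2.le⟩)).trans ?_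
        refine mul_le_mul_of_nonneg_left ?_ hδ0
        rw [show μ + θ * (s - μ) - (μ + θ * (t - μ)) = θ * (s - t) by ring, abs_mul,
          abs_of_nonneg hθ.1]
        exact mul_le_of_le_one_left (abs_nonneg _) hθ.2.le)
    rw [slopeQ_of_ne _ _ _ h, abs_div, div_le_iff₀ (abs_pos.2 (sub_ne_zero.2 h))]
    refine le_of_eq_of_le ?_ hb
    rw [Real.norm_eq_abs]
    congr 1
    simp only [one_mul, zero_mul, add_zero, add_sub_cancel]
    ring

theorem slopeL_sub (f f' g g' : ℝ → ℝ) (s t : ℝ) :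
    slopeL (fun r => f r - g r) (fun r => f' r - g' r) s t =
      slopeL f f' s t - slopeL g g' s t := by
  unfold slopeL
  split_ifs <;> ring

theorem slopeQ_sub (f f' g g' : ℝ → ℝ) (s t μ : ℝ) :
    slopeQ (fun r => f r - g r) (fun r => f' r - g' r) s t μ =
      slopeQ f f' s t μ - slopeQ g g' s t μ := by
  unfold slopeQ
  rw [← slopeL_sub]
  congr 1 <;> ext r <;> ring

/-- Quadratic forms of entrywise close matrices are close. -/
theorem abs_sum_sub_sum_le {m : ℕ} {K L : Fin m → Fin m → ℝ} {δ : ℝ}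
    (h : ∀ i j, |K i j - L i j| ≤ δ) (x : Fin m → ℝ) :
    |∑ i, ∑ j, x i * x j * K i j - ∑ i, ∑ j, x i * x j * L i j| ≤ δ * (∑ i, |x i|) ^ 2 := by
  rw [← Finset.sum_sub_distrib, sq, Finset.sum_mul_sum, Finset.mul_sum]
  refine (Finset.abs_sum_le_sum_abs _ _).trans (Finset.sum_le_sum fun i _ => ?_)
  rw [← Finset.sum_sub_distrib, Finset.mul_sum]
  refine (Finset.abs_sum_le_sum_abs _ _).trans (Finset.sum_le_sum fun j _ => ?_)
  rw [← mul_sub, abs_mul, abs_mul, mul_comm]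
  exact mul_le_mul_of_nonneg_right (h i j) (by positivity)

end DividedDifferenceBounds

/-! ### From matrix monotonicity to positive Loewner matrices. -/

section

open Polynomial

theorem nonneg_of_forall_pos_neg_mul_le {Q C : ℝ} (hC : 0 ≤ C) (h : ∀ δ > 0, -(δ * C) ≤ Q) :
    0 ≤ Q := by
  by_contra! hQ
  have h1 := h (-Q / (2 * (C + 1))) (by apply div_pos <;> linarith)
  have h2 : -Q / (2 * (C + 1)) * C ≤ -Q / 2 := by
    rw [div_mul_eq_mul_div, div_le_div_iff₀ (by positivity) (by norm_num)]
    nlinarith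
  linarith

variable {m : ℕ}

theorem isHermitian_diagonal_ofReal (s : Fin m → ℝ) :
    (Matrix.diagonal fun i => (s i : ℂ)).IsHermitian := by
  rw [Matrix.IsHermitian, Matrix.diagonal_conjTranspose]
  congr 1
  ext i
  simp

theorem Matrix.IsHermitian.real_smul {A : Matrix (Fin m) (Fin m) ℂ} (hA : A.IsHermitian) (c : ℝ) :
    (c • A).IsHermitian := by
  rw [Matrix.IsHermitian, Matrix.conjTranspose_smul, hA.eq, star_trivial]

theorem isHermitian_convexComb {A B : Matrix (Fin m) (Fin m) ℂ} (hA : A.IsHermitian)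
    (hB : B.IsHermitian) (c : ℝ) : (c • A + (1 - c) • B).IsHermitian :=
  (hA.real_smul c).add (hB.real_smul (1 - c))

theorem spectrum_convexComb_subset {A B : Matrix (Fin m) (Fin m) ℂ} (hA : A.IsHermitian)
    (hB : B.IsHermitian) {a b : ℝ} (hAs : spectrum ℝ A ⊆ Icc a b) (hBs : spectrum ℝ B ⊆ Icc a b)
    {c : ℝ} (hc0 : 0 ≤ c) (hc1 : c ≤ 1) : spectrum ℝ (c • A + (1 - c) • B) ⊆ Icc a b := by
  rw [spectrum_subset_Icc_iff (isHermitian_convexComb hA hB c)]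
  intro z
  have h1 := (spectrum_subset_Icc_iff hA a b).1 hAs z
  have h2 := (spectrum_subset_Icc_iff hB a b).1 hBs z
  rw [qform_add, qform_smul, qform_smul]
  have h3 := sub_nonneg.2 hc1
  constructor
  · linarith [mul_le_mul_of_nonneg_left h1.1 hc0, mul_le_mul_of_nonneg_left h2.1 h3]
  · linarith [mul_le_mul_of_nonneg_left h1.2 hc0, mul_le_mul_of_nonneg_left h2.2 h3]

theorem qform_ofReal (A : Matrix (Fin m) (Fin m) ℂ) (x : Fin m → ℝ) :
    qform A (fun i => (x i : ℂ)) = ∑ i, ∑ j, x i * x j * (A i j).re := by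
  rw [qform_eq_sum]
  refine Finset.sum_congr rfl fun i _ => Finset.sum_congr rfl fun j _ => ?_
  simp
  ring

/-- The matrix all of whose entries are `1`. -/
def onesMatrix (m : ℕ) : Matrix (Fin m) (Fin m) ℂ := Matrix.of fun _ _ => 1

theorem isHermitian_onesMatrix : (onesMatrix m).IsHermitian := by
  ext i j
  simp [onesMatrix]

theorem qform_onesMatrix (x : Fin m → ℂ) : qform (onesMatrix m) x = normSq (∑ i, x i) := by
  have h : (normSq (∑ i, x i) : ℂ) = ∑ i, ∑ j, star (x i) * x j := by
    rw [Complex.normSq_eq_conj_mul_self, map_sum, Finset.sum_mul_sum]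
    rfl
  rw [qform_eq_sum, ← Complex.ofReal_re (normSq _), h]
  simp [onesMatrix]

theorem qform_onesMatrix_le (x : Fin m → ℂ) : qform (onesMatrix m) x ≤ m * sqNorm x := by
  rw [qform_onesMatrix, Complex.normSq_eq_norm_sq]
  calc ‖∑ i, x i‖ ^ 2 ≤ (∑ i, ‖x i‖) ^ 2 := by gcongr; exact norm_sum_le _ _
    _ ≤ m * ∑ i, ‖x i‖ ^ 2 := by
      simpa using sq_sum_le_card_mul_sum_sq (s := Finset.univ) (f := fun i => ‖x i‖)
    _ = m * sqNorm x := by simp [sqNorm, Complex.normSq_eq_norm_sq]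

theorem sqFrob_smul_onesMatrix (t : ℝ) : sqFrob (t • onesMatrix m) = (t * m) ^ 2 := by
  simp [sqFrob, onesMatrix, Complex.normSq_apply]
  ring

/-- The margin η lies on the right only, because the diagonal matrix of the s_i will be perturbed by
positive semidefinite matrices. Nonemptiness of J serves the case m = 0. -/
theorem exists_Icc_subset_of_forall_mem {J : Set ℝ} (hJ : IsOpen J) (hJ' : J.OrdConnected)
    (hne : J.Nonempty) {s : Fin m → ℝ} (hs : ∀ i, s i ∈ J) :
    ∃ a b η : ℝ, 0 < η ∧ a ≤ b ∧ Icc a b ⊆ J ∧ ∀ i, a ≤ s i ∧ s i + η ≤ b := by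
  rcases isEmpty_or_nonempty (Fin m) with he | he
  · obtain ⟨c, hc⟩ := hne
    exact ⟨c, c, 1, one_pos, le_rfl, by simpa using hc, fun i => he.elim i⟩
  · obtain ⟨i₀, h₀⟩ := Finite.exists_min s
    obtain ⟨i₁, h₁⟩ := Finite.exists_max s
    obtain ⟨η, hη, hball⟩ := Metric.isOpen_iff.1 hJ _ (hs i₁)
    refine ⟨s i₀, s i₁ + η / 2, η / 2, half_pos hη, by linarith [h₀ i₁], hJ'.out (hs i₀)
      (hball ?_), fun i => ⟨h₀ i, by linarith [h₁ i]⟩⟩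
    rw [Metric.mem_ball, Real.dist_eq, add_sub_cancel_left, abs_of_pos] <;> linarith

theorem Matrix.cfc_fun_sub (A : Matrix (Fin m) (Fin m) ℂ) (f g : ℝ → ℝ) :
    cfc (fun t => f t - g t) A = cfc f A - cfc g A :=
  cfc_sub f g A (Matrix.finite_real_spectrum.continuousOn _)
    (Matrix.finite_real_spectrum.continuousOn _)

theorem Matrix.IsHermitian.cfc_polynomial {A : Matrix (Fin m) (Fin m) ℂ} (hA : A.IsHermitian)
    (p : ℝ[X]) : cfc (fun t => p.eval t) A = aeval A p :=
  _root_.cfc_polynomial p A hA.isSelfAdjoint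

/-- The Loewner matrices of a matrix monotone `C¹` function are positive semidefinite. -/
theorem IsMatrixMonotone.sum_slopeL_nonneg {J : Set ℝ} (hJ : IsOpen J) (hJ' : J.OrdConnected)
    (hne : J.Nonempty) {h h' : ℝ → ℝ} (hmono : IsMatrixMonotone m J h)
    (hh : ∀ t ∈ J, HasDerivAt h (h' t) t) (hh' : ContinuousOn h' J) {s : Fin m → ℝ}
    (hs : ∀ i, s i ∈ J) (x : Fin m → ℝ) :
    0 ≤ ∑ i, ∑ j, x i * x j * slopeL h h' (s i) (s j) := by
  obtain ⟨a, b, η, hη, hab, hsub, hsab⟩ := exists_Icc_subset_of_forall_mem hJ hJ' hne hs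
  set S : ℝ := (∑ i, |x i|) ^ 2 with hS
  have hS0 : 0 ≤ S := sq_nonneg _
  -- The error is δ m S from replacing h by p in the matrix increments, plus δ S from replacing the
  -- divided differences of p by those of h.
  refine nonneg_of_forall_pos_neg_mul_le (C := (m + 1) * S) (by positivity) fun δ hδ => ?_
  obtain ⟨p, -, hp⟩ := exists_polynomial_near_C1 hab (fun t ht => hh t (hsub ht))
    (hh'.mono hsub) hδ
  set A := Matrix.diagonal fun i => (s i : ℂ) with hAdef
  -- The derivative of p at a diagonal matrix multiplies H entrywise by the divided differences; the
  -- all-ones direction is positive semidefinite and returns the Loewner matrix itself.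
  set H := onesMatrix m with hH
  have hA : A.IsHermitian := isHermitian_diagonal_ofReal s
  have hB : ∀ t : ℝ, (A + t • H).IsHermitian := fun t =>
    hA.add (isHermitian_onesMatrix.real_smul t)
  have hspec : ∀ t : ℝ, 0 ≤ t → t * m ≤ η → spectrum ℝ (A + t • H) ⊆ Icc a b := by
    intro t ht htm
    rw [spectrum_subset_Icc_iff (hB t)]
    intro z
    have h1 : a * sqNorm z ≤ qform A z := by
      rw [qform_diagonal, sqNorm, Finset.mul_sum]
      exact Finset.sum_le_sum fun i _ =>
        mul_le_mul_of_nonneg_right (hsab i).1 (Complex.normSq_nonneg _)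
    have h2 : qform A z ≤ (b - η) * sqNorm z := by
      rw [qform_diagonal, sqNorm, Finset.mul_sum]
      exact Finset.sum_le_sum fun i _ =>
        mul_le_mul_of_nonneg_right (by linarith [(hsab i).2]) (Complex.normSq_nonneg _)
    have h3 : 0 ≤ qform H z := by rw [qform_onesMatrix]; exact Complex.normSq_nonneg _
    have h4 := qform_onesMatrix_le z
    have h5 : t * qform H z ≤ η * sqNorm z := by
      calc t * qform H z ≤ t * (m * sqNorm z) := by gcongr
        _ = t * m * sqNorm z := by ring
        _ ≤ η * sqNorm z := mul_le_mul_of_nonneg_right htm (sqNorm_nonneg z)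
    rw [qform_add, qform_smul]
    constructor
    · have := mul_nonneg ht h3
      linarith
    · linarith
  have hspecA : spectrum ℝ A ⊆ Icc a b := by
    simpa using hspec 0 le_rfl (by simpa using hη.le)
  have hlip : ∀ u ∈ Icc a b, ∀ v ∈ Icc a b,
      |(h u - p.eval u) - (h v - p.eval v)| ≤ δ * |u - v| := fun u hu v hv =>
    Convex.norm_image_sub_le_of_norm_hasDerivWithin_le (f := fun t => h t - p.eval t)
      (fun t ht => ((hh t (hsub ht)).fun_sub (p.hasDerivAt t)).hasDerivWithinAt)
      (fun t ht => by rw [Real.norm_eq_abs, abs_sub_comm]; exact hp t ht)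
      (convex_Icc a b) hv hu
  set z : Fin m → ℂ := fun i => (x i : ℂ) with hz
  -- The matrix increment of h is nonnegative by monotonicity, and that of h - p is at most δ t m in
  -- Frobenius norm, so the increment of p is almost nonnegative.
  have hincr : ∀ t : ℝ, 0 < t → t * m ≤ η →
      -(δ * m * S) ≤ (qform (aeval (A + t • H) p) z - qform (aeval A p) z) / t := by
    intro t ht htm
    have hsB := hspec t ht.le htm
    have hpos : (A + t • H - A).PosSemidef := by
      rw [add_sub_cancel_left, posSemidef_iff_qform]
      refine ⟨isHermitian_onesMatrix.real_smul t, fun w => ?_⟩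
      rw [qform_smul, qform_onesMatrix]
      exact mul_nonneg ht.le (Complex.normSq_nonneg _)
    have h1 := ((posSemidef_iff_qform _).1
      (hmono A _ hA (hB t) (hspecA.trans hsub) (hsB.trans hsub) hpos)).2 z
    have h2 := sqFrob_cfc_sub_le hA (hB t) hspecA hsB hlip
    rw [add_sub_cancel_left, sqFrob_smul_onesMatrix, ← mul_pow] at h2
    have h3 := abs_qform_le_of_sqFrob_le (by positivity) h2 z
    rw [Matrix.cfc_fun_sub, Matrix.cfc_fun_sub, (hB t).cfc_polynomial, hA.cfc_polynomial] at h3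
    simp only [qform_sub] at h1 h3
    have h4 : (∑ i, ‖z i‖) ^ 2 = S := by simp [hz, hS]
    rw [h4] at h3
    rw [le_div_iff₀ ht]
    linarith [(abs_le.1 h3).2]
  have hderiv := hasDerivAt_qform_aeval A H p z 0
  have hval : qform (polyD p (A + (0 : ℝ) • H) H) z =
      ∑ i, ∑ j, x i * x j * polyL p (s i) (s j) := by
    rw [zero_smul, add_zero, qform_ofReal]
    simp [hAdef, polyD_diagonal, hH, onesMatrix]
  rw [hval] at hderiv
  have hge : -(δ * m * S) ≤ ∑ i, ∑ j, x i * x j * polyL p (s i) (s j) := by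
    refine ge_of_tendsto ((hasDerivAt_iff_tendsto_slope.1 hderiv).mono_left
      (nhdsGT_le_nhdsNE 0)) ?_
    have hcont : ContinuousAt (fun t : ℝ => t * m) 0 := by fun_prop
    have hev := hcont.tendsto.eventually_lt_const (u := η) (by simpa using hη)
    filter_upwards [self_mem_nhdsWithin, nhdsWithin_le_nhds hev] with t ht htm
    rw [slope_def_field, sub_zero, zero_smul, add_zero]
    exact hincr t ht htm.le
  have hclose := abs_sum_sub_sum_le (δ := δ) (K := fun i j => polyL p (s i) (s j))
    (L := fun i j => slopeL h h' (s i) (s j)) (fun i j => by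
      rw [polyL_eq, ← slopeL_sub]
      exact abs_slopeL_le (fun t ht => (p.hasDerivAt t).fun_sub (hh t (hsub ht))) hp
        ⟨(hsab i).1, by linarith [(hsab i).2]⟩ ⟨(hsab j).1, by linarith [(hsab j).2]⟩) x
  have := (abs_le.1 hclose).2
  nlinarith

/-! ### From second divided differences to matrix convexity. -/

/-- Lower bound for the second derivative of a polynomial of matrices. -/
theorem le_qform_polyD₂ {a b δ : ℝ} {p : ℝ[X]}
    (hp : ∀ s : Fin m → ℝ, (∀ i, s i ∈ Icc a b) → ∀ μ ∈ Icc a b, ∀ x : Fin m → ℝ,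
      -(δ * ∑ i, x i ^ 2) ≤ ∑ i, ∑ j, x i * x j * polyQ p (s i) μ (s j))
    (hδ : 0 ≤ δ) {X H : Matrix (Fin m) (Fin m) ℂ} (hX : X.IsHermitian) (hH : H.IsHermitian)
    (hXs : spectrum ℝ X ⊆ Icc a b) (x : Fin m → ℂ) :
    -(δ * (sqFrob H * sqNorm x)) ≤ qform (polyD₂ p X H) x := by
  obtain ⟨U, d, hU, hU', hd, -, hXd⟩ := hX.exists_diagonalization
  rw [hd] at hXs
  set K := star U * H * U with hK
  have hKH : K.IsHermitian := by
    rw [Matrix.IsHermitian, hK, ← Matrix.star_eq_conjTranspose, star_mul, star_mul, star_star,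
      Matrix.star_eq_conjTranspose H, hH.eq, mul_assoc]
  have hHK : H = U * K * star U := by
    calc H = (U * star U) * H * (U * star U) := by rw [hU', one_mul, mul_one]
      _ = _ := by rw [hK]; noncomm_ring
  have hfrob : sqFrob H = sqFrob K := by
    rw [hK, sqFrob_mul_unitary _ hU', sqFrob_unitary_mul _ (by simpa using hU')]
  set y := star U *ᵥ x with hy
  rw [hfrob, ← sqNorm_star_mulVec x hU', hXd]
  conv_rhs => rw [hHK]
  rw [polyD₂_conj p hU hU', qform_conj, ← hy, qform_eq_sum]
  -- Since K is Hermitian, K_ik = conj(K_ki), so for each k the form is that of the complex vector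
  -- (K_ki y_i)_i. The coefficients are real, so it splits into real and imaginary parts.
  have e : ∑ i, ∑ j, (star (y i) * (polyD₂ p (Matrix.diagonal fun i => (d i : ℂ)) K i j * y j)).re =
      ∑ k, (∑ i, ∑ j, (K k i * y i).re * (K k j * y j).re * polyQ p (d i) (d k) (d j) +
        ∑ i, ∑ j, (K k i * y i).im * (K k j * y j).im * polyQ p (d i) (d k) (d j)) := by
    simp only [polyD₂_diagonal, Finset.sum_mul, Finset.mul_sum, Complex.re_sum,
      ← Finset.sum_add_distrib]
    rw [Finset.sum_comm, Finset.sum_comm (s := Finset.univ (α := Fin m))]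
    conv_rhs => rw [Finset.sum_comm]
    refine Finset.sum_congr rfl fun i _ => ?_
    rw [Finset.sum_comm]
    refine Finset.sum_congr rfl fun k _ => Finset.sum_congr rfl fun j _ => ?_
    have hki : K i k = star (K k i) := (hKH.apply i k).symm
    rw [hki]
    simp
    ring
  rw [e]
  have hterm : ∀ k, -(δ * ∑ i, normSq (K k i * y i)) ≤
      ∑ i, ∑ j, (K k i * y i).re * (K k j * y j).re * polyQ p (d i) (d k) (d j) +
        ∑ i, ∑ j, (K k i * y i).im * (K k j * y j).im * polyQ p (d i) (d k) (d j) := by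
    intro k
    have h1 := hp d (fun i => hXs ⟨i, rfl⟩) (d k) (hXs ⟨k, rfl⟩) fun i => (K k i * y i).re
    have h2 := hp d (fun i => hXs ⟨i, rfl⟩) (d k) (hXs ⟨k, rfl⟩) fun i => (K k i * y i).im
    have h3 : ∑ i, normSq (K k i * y i) =
        ∑ i, (K k i * y i).re ^ 2 + ∑ i, (K k i * y i).im ^ 2 := by
      rw [← Finset.sum_add_distrib]
      exact Finset.sum_congr rfl fun i _ => by rw [Complex.normSq_apply, sq, sq]
    rw [h3, mul_add]
    linarith
  refine le_trans ?_ (Finset.sum_le_sum fun k _ => hterm k)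
  rw [Finset.sum_neg_distrib, ← Finset.mul_sum, neg_le_neg_iff]
  refine mul_le_mul_of_nonneg_left ?_ hδ
  rw [sqFrob, Finset.sum_mul]
  refine Finset.sum_le_sum fun k _ => ?_
  rw [sqNorm, Finset.mul_sum]
  refine Finset.sum_le_sum fun i _ => ?_
  rw [Complex.normSq_mul]
  exact mul_le_mul_of_nonneg_right (Finset.single_le_sum (f := fun i => normSq (K k i))
    (fun _ _ => Complex.normSq_nonneg _) (Finset.mem_univ i)) (Complex.normSq_nonneg _)

theorem qform_aeval_convex {a b δ : ℝ} {p : ℝ[X]}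
    (hp : ∀ s : Fin m → ℝ, (∀ i, s i ∈ Icc a b) → ∀ μ ∈ Icc a b, ∀ x : Fin m → ℝ,
      -(δ * ∑ i, x i ^ 2) ≤ ∑ i, ∑ j, x i * x j * polyQ p (s i) μ (s j))
    (hδ : 0 ≤ δ) {A B : Matrix (Fin m) (Fin m) ℂ} (hA : A.IsHermitian) (hB : B.IsHermitian)
    (hAs : spectrum ℝ A ⊆ Icc a b) (hBs : spectrum ℝ B ⊆ Icc a b) {c : ℝ} (hc0 : 0 ≤ c)
    (hc1 : c ≤ 1) (x : Fin m → ℂ) :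
    qform (aeval (c • A + (1 - c) • B) p) x ≤
      c * qform (aeval A p) x + (1 - c) * qform (aeval B p) x
        + δ * (sqFrob (B - A) * sqNorm x) := by
  set H := B - A with hH
  set C := δ * (sqFrob H * sqNorm x) with hC
  have hC0 : 0 ≤ C := mul_nonneg hδ (mul_nonneg (sqFrob_nonneg _) (sqNorm_nonneg _))
  have hline : ∀ t : ℝ, A + t • H = (1 - t) • A + t • B := fun t => by
    rw [hH, smul_sub, sub_smul, one_smul]; abel
  have hXH : ∀ t : ℝ, (A + t • H).IsHermitian := fun t => hA.add ((hB.sub hA).real_smul t)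
  have hspec : ∀ t ∈ Icc (0 : ℝ) 1, spectrum ℝ (A + t • H) ⊆ Icc a b := by
    intro t ht
    rw [hline]
    simpa only [sub_sub_cancel] using spectrum_convexComb_subset hA hB hAs hBs
      (sub_nonneg.2 ht.2) (by linarith [ht.1] : 1 - t ≤ 1)
  -- The second derivative along the segment is at least -2C, so adding C t² makes the function
  -- convex; evaluating at t = 1 - c costs at most C.
  have hd1 : ∀ t : ℝ, HasDerivAt (fun t : ℝ => qform (aeval (A + t • H) p) x + C * t ^ 2)
      (qform (polyD p (A + t • H) H) x + 2 * C * t) t := fun t =>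
    ((hasDerivAt_qform_aeval A H p x t).fun_add ((hasDerivAt_pow 2 t).const_mul C)).congr_deriv
      (by simp; ring)
  have hd2 : ∀ t : ℝ, HasDerivAt (fun t : ℝ => qform (polyD p (A + t • H) H) x + 2 * C * t)
      (2 * qform (polyD₂ p (A + t • H) H) x + 2 * C) t := fun t =>
    ((hasDerivAt_qform_polyD A H p x t).fun_add ((hasDerivAt_id' t).const_mul (2 * C))).congr_deriv
      (by simp)
  have hconv : ConvexOn ℝ (Icc (0 : ℝ) 1)
      (fun t : ℝ => qform (aeval (A + t • H) p) x + C * t ^ 2) := by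
    refine convexOn_of_hasDerivWithinAt2_nonneg (convex_Icc 0 1)
      (fun t _ => (hd1 t).continuousAt.continuousWithinAt)
      (fun t _ => (hd1 t).hasDerivWithinAt) (fun t _ => (hd2 t).hasDerivWithinAt) fun t ht => ?_
    have := le_qform_polyD₂ hp hδ (hXH t) (hB.sub hA) (hspec t (interior_subset ht)) x
    linarith
  have h := hconv.2 (left_mem_Icc.2 zero_le_one) (right_mem_Icc.2 zero_le_one) hc0
    (sub_nonneg.2 hc1) (by ring)
  simp only [smul_eq_mul, mul_zero, mul_one, zero_add] at h
  rw [hline, hline, hline, sub_sub_cancel] at h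
  simp only [sub_zero, one_smul, zero_smul, add_zero, sub_self, zero_add] at h
  nlinarith [mul_nonneg hC0 (sq_nonneg (1 - c)), mul_nonneg hC0 hc0]

theorem eventually_add_mul_ne_zero (u : ℝ) {v : ℝ} (hv : v ≠ 0) :
    ∀ᶠ η : ℝ in 𝓝[>] 0, u + η * v ≠ 0 := by
  rcases eq_or_ne u 0 with rfl | hu
  · filter_upwards [self_mem_nhdsWithin] with η hη
    rw [zero_add]
    exact mul_ne_zero (ne_of_gt hη) hv
  · have : ContinuousAt (fun η : ℝ => u + η * v) 0 := by fun_prop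
    exact nhdsWithin_le_nhds (this.eventually_ne (by simpa using hu))

/-- A polynomial close in `C²` to a function with positive second divided difference matrices
has almost positive ones, also at coinciding points. -/
theorem QPos.le_sum_polyQ {a b b' δ : ℝ} (hbb' : b < b') {g g' g'' : ℝ → ℝ}
    (hg : ∀ t ∈ Icc a b', HasDerivAt g (g' t) t) (hg' : ∀ t ∈ Icc a b', HasDerivAt g' (g'' t) t)
    (hQ : QPos m (Icc a b') g g') {p : ℝ[X]}
    (hp : ∀ t ∈ Icc a b', |p.derivative.derivative.eval t - g'' t| ≤ δ) (hδ : 0 ≤ δ)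
    (s : Fin m → ℝ) (hs : ∀ i, s i ∈ Icc a b) (μ : ℝ) (hμ : μ ∈ Icc a b) (x : Fin m → ℝ) :
    -(δ * m * ∑ i, x i ^ 2) ≤ ∑ i, ∑ j, x i * x j * polyQ p (s i) μ (s j) := by
  have hdist : ∀ σ : Fin m → ℝ, Function.Injective σ → (∀ i, σ i ∈ Icc a b') → ∀ ν ∈ Icc a b',
      (∀ i, σ i ≠ ν) → -(δ * m * ∑ i, x i ^ 2) ≤
        ∑ i, ∑ j, x i * x j * polyQ p (σ i) ν (σ j) := by
    intro σ hσ hσJ ν hν hσν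
    have h1 := hQ σ hσ hσJ ν hν hσν x
    have hclose := abs_sum_sub_sum_le (δ := δ) (K := fun i j => polyQ p (σ i) ν (σ j))
      (L := fun i j => slopeQ g g' (σ i) (σ j) ν) (fun i j => by
        rw [polyQ_eq p (hσν i) (hσν j), ← slopeQ_sub]
        exact abs_slopeQ_le (fun t ht => (p.hasDerivAt t).fun_sub (hg t ht))
          (fun t ht => (p.derivative.hasDerivAt t).fun_sub (hg' t ht)) hp
          (hσJ i) (hσJ j) hν (hσν i) (hσν j)) x
    have h2 : (∑ i, |x i|) ^ 2 ≤ m * ∑ i, x i ^ 2 := by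
      simpa using sq_sum_le_card_mul_sum_sq (s := Finset.univ) (f := fun i => |x i|)
    have h3 := mul_le_mul_of_nonneg_left h2 hδ
    linarith [(abs_le.1 hclose).1]
  -- Moving node i by η (i + 1) makes the nodes distinct from each other and from μ for all small η
  -- > 0; the +1 moves node 0 as well. The room between b and b' receives the moved nodes.
  have hcont : ContinuousAt (fun η : ℝ => ∑ i, ∑ j, x i * x j *
      polyQ p (s i + η * (i + 1)) μ (s j + η * (j + 1))) 0 := by
    refine Continuous.continuousAt (continuous_finsetSum _ fun i _ =>
      continuous_finsetSum _ fun j _ => continuous_const.mul ?_)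
    exact (continuous_polyQ p).comp (f := fun η : ℝ =>
      (s i + η * (i + 1), μ, s j + η * (j + 1))) (by fun_prop)
  have hlim := hcont.tendsto.mono_left (nhdsWithin_le_nhds (s := Ioi 0))
  simp only [zero_mul, add_zero] at hlim
  refine ge_of_tendsto hlim ?_
  have hle : ∀ i, ∀ᶠ η : ℝ in 𝓝[>] 0, s i + η * (i + 1) ≤ b' := fun i => by
    have : ContinuousAt (fun η : ℝ => s i + η * (i + 1)) 0 := by fun_prop
    have h := this.tendsto.eventually_lt_const (u := b') (by simpa using (hs i).2.trans_lt hbb')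
    exact nhdsWithin_le_nhds (h.mono fun _ h => h.le)
  have hneμ : ∀ i, ∀ᶠ η : ℝ in 𝓝[>] 0, s i + η * (i + 1) ≠ μ := fun i => by
    filter_upwards [eventually_add_mul_ne_zero (s i - μ) (v := (i : ℝ) + 1) (by positivity)]
      with η hη h
    exact hη (by linarith)
  have hinj : ∀ i j : Fin m, ∀ᶠ η : ℝ in 𝓝[>] 0,
      s i + η * (i + 1) = s j + η * (j + 1) → i = j := fun i j => by
    rcases eq_or_ne i j with rfl | hij
    · exact Eventually.of_forall fun _ _ => rfl
    · have hv : (i : ℝ) - j ≠ 0 := sub_ne_zero.2 (by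
        simpa [Fin.ext_iff] using hij)
      filter_upwards [eventually_add_mul_ne_zero (s i - s j) hv] with η hη h
      exact absurd (by linarith) hη
  filter_upwards [self_mem_nhdsWithin, eventually_all.2 hle, eventually_all.2 hneμ,
    eventually_all.2 fun i => eventually_all.2 (hinj i)] with η hη h1 h2 h3
  have hη : 0 < η := hη
  refine hdist _ (fun i j hij => h3 i j hij) (fun i => ⟨?_, h1 i⟩) μ
    ⟨hμ.1, hμ.2.trans hbb'.le⟩ h2
  have : 0 ≤ η * ((i : ℝ) + 1) := by positivity
  linarith [(hs i).1]

/-- Positivity of second divided differences implies matrix convexity, for `C²` functions. -/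
theorem QPos.qform_cfc_convex {a b b' : ℝ} (hab : a ≤ b) (hbb' : b < b') {g g' g'' : ℝ → ℝ}
    (hg : ∀ t ∈ Icc a b', HasDerivAt g (g' t) t) (hg' : ∀ t ∈ Icc a b', HasDerivAt g' (g'' t) t)
    (hg'' : ContinuousOn g'' (Icc a b')) (hQ : QPos m (Icc a b') g g')
    {A B : Matrix (Fin m) (Fin m) ℂ} (hA : A.IsHermitian) (hB : B.IsHermitian)
    (hAs : spectrum ℝ A ⊆ Icc a b) (hBs : spectrum ℝ B ⊆ Icc a b) {c : ℝ} (hc0 : 0 ≤ c)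
    (hc1 : c ≤ 1) (x : Fin m → ℂ) :
    qform (cfc g (c • A + (1 - c) • B)) x ≤
      c * qform (cfc g A) x + (1 - c) * qform (cfc g B) x := by
  have hM := isHermitian_convexComb hA hB c
  have hMs := spectrum_convexComb_subset hA hB hAs hBs hc0 hc1
  rw [← sub_nonneg]
  have hab' : a ≤ b' := hab.trans hbb'.le
  have hF := mul_nonneg (sqFrob_nonneg (B - A)) (sqNorm_nonneg x)
  have hN := sqNorm_nonneg x
  -- The first term of C is the defect in positivity of p. The second is the error of replacing g by
  -- p on both sides, where the weights c and 1 - c add up to one.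
  refine nonneg_of_forall_pos_neg_mul_le
    (C := m * (sqFrob (B - A) * sqNorm x) + 2 * ((b' - a) * (b' - a) * sqNorm x))
    (by positivity) fun δ hδ => ?_
  obtain ⟨p, hp, hp'⟩ := exists_polynomial_near_C2 hab' hg hg' hg'' hδ
  have key := qform_aeval_convex (hQ.le_sum_polyQ hbb' hg hg' hp' hδ.le) (by positivity)
    hA hB hAs hBs hc0 hc1 x
  have hcl : ∀ {D : Matrix (Fin m) (Fin m) ℂ}, D.IsHermitian → spectrum ℝ D ⊆ Icc a b →
      |qform (aeval D p) x - qform (cfc g D) x| ≤ δ * (b' - a) * (b' - a) * sqNorm x := by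
    intro D hD hDs
    rw [← hD.cfc_polynomial]
    exact abs_qform_cfc_sub_le hD hDs (fun t ht => hp t ⟨ht.1, ht.2.trans hbb'.le⟩) x
  have h1 := (abs_le.1 (hcl hM hMs)).1
  have h2 := mul_le_mul_of_nonneg_left (abs_le.1 (hcl hA hAs)).2 hc0
  have h3 := mul_le_mul_of_nonneg_left (abs_le.1 (hcl hB hBs)).2 (sub_nonneg.2 hc1)
  linarith

end

/-! ### Assembly on [0, α). -/

theorem slopeQ_comp_add (f f' : ℝ → ℝ) (ε s t μ : ℝ) :
    slopeQ (fun r => f (r + ε)) (fun r => f' (r + ε)) s t μ =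
      slopeQ f f' (s + ε) (t + ε) (μ + ε) := by
  simp [slopeQ, slopeL]

theorem QPos.comp_add {m : ℕ} {J J' : Set ℝ} {f f' : ℝ → ℝ} {ε : ℝ} (h : QPos m J f f')
    (hJ' : ∀ t ∈ J', t + ε ∈ J) :
    QPos m J' (fun r => f (r + ε)) (fun r => f' (r + ε)) := by
  intro s hs hsJ μ hμ hsμ x
  simp only [slopeQ_comp_add]
  exact h (fun i => s i + ε) (fun i j hij => hs (add_right_cancel hij))
    (fun i => hJ' _ (hsJ i)) (μ + ε) (hJ' μ hμ) (fun i hi => hsμ i (add_right_cancel hi)) x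

theorem isOpen_openInterval (α : EReal) : IsOpen (openInterval α) :=
  isOpen_Ioi.inter (isOpen_Iio.preimage continuous_coe_real_ereal)

theorem Ioc_zero_subset_openInterval {α : EReal} {t : ℝ} (ht : t ∈ openInterval α) :
    Ioc 0 t ⊆ openInterval α :=
  fun _ hs => ⟨hs.1, (EReal.coe_le_coe_iff.2 hs.2).trans_lt ht.2⟩

theorem ordConnected_openInterval (α : EReal) : (openInterval α).OrdConnected :=
  ⟨fun _ ha _ hb _ ht => Ioc_zero_subset_openInterval hb ⟨ha.1.trans_le ht.1, ht.2⟩⟩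

theorem openInterval_subset_leftClosedInterval (α : EReal) :
    openInterval α ⊆ leftClosedInterval α := fun _ ht => ⟨ht.1.le, ht.2⟩

theorem exists_mem_openInterval_gt {α : EReal} {b : ℝ} (hb : b ∈ leftClosedInterval α) :
    ∃ β ∈ openInterval α, b < β := by
  obtain ⟨β, h1, h2⟩ := EReal.lt_iff_exists_real_btwn.1 hb.2
  have h1 := EReal.coe_lt_coe_iff.1 h1
  exact ⟨β, ⟨hb.1.trans_lt h1, h2⟩, h1⟩

theorem exists_spectrum_subset_Icc {m : ℕ} {α : EReal} (hα : 0 < α)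
    {A B : Matrix (Fin m) (Fin m) ℂ} (hA : spectrum ℝ A ⊆ leftClosedInterval α)
    (hB : spectrum ℝ B ⊆ leftClosedInterval α) :
    ∃ b ∈ leftClosedInterval α, spectrum ℝ A ⊆ Icc 0 b ∧ spectrum ℝ B ⊆ Icc 0 b := by
  obtain ⟨b, hb, hmax⟩ := Set.exists_max_image (insert 0 (spectrum ℝ A ∪ spectrum ℝ B)) id
    ((Matrix.finite_real_spectrum.union Matrix.finite_real_spectrum).insert 0)
    (insert_nonempty _ _)
  refine ⟨b, ?_, fun t ht => ⟨(hA ht).1, hmax t (Or.inr (Or.inl ht))⟩,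
    fun t ht => ⟨(hB ht).1, hmax t (Or.inr (Or.inr ht))⟩⟩
  rcases hb with rfl | hb | hb
  · exact ⟨le_rfl, hα⟩
  · exact hA hb
  · exact hB hb

theorem leftClosedInterval_mem_nhds {α : EReal} {t : ℝ} (ht : t ∈ openInterval α) :
    leftClosedInterval α ∈ 𝓝 t :=
  mem_of_superset ((isOpen_openInterval α).mem_nhds ht) (openInterval_subset_leftClosedInterval α)

theorem hasDerivAt_of_mem_classQ {n : ℕ} {α : EReal} {f : ℝ → ℝ}
    (hf : f ∈ classQ n (leftClosedInterval α)) {t : ℝ} (ht : t ∈ openInterval α) :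
    HasDerivAt f (deriv f t) t :=
  ((hf.1.differentiableOn one_ne_zero).differentiableAt
    (leftClosedInterval_mem_nhds ht)).hasDerivAt

theorem lCPos_of_mem_classQ {n : ℕ} {α : EReal} {f : ℝ → ℝ}
    (hf : f ∈ classQ n (leftClosedInterval α)) : LCPos n (openInterval α) f (deriv f) := by
  intro s _ hsJ x hx
  have h := (hf.2 s fun i => openInterval_subset_leftClosedInterval α (hsJ i)).2
    (fun i => (x i : ℂ)) (by exact_mod_cast hx)
  change 0 ≤ qform _ _ at h
  rw [qform_ofReal] at h
  refine h.trans_eq (Finset.sum_congr rfl fun i _ => Finset.sum_congr rfl fun j _ => ?_)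
  rw [loewnerMatrix, Matrix.of_apply, Complex.ofReal_re, dividedDiff, slopeL,
    derivWithin_of_mem_nhds (leftClosedInterval_mem_nhds (hsJ i))]

/-- Positivity is known only on (0, α), while eigenvalues may be 0. Averaging f over [t + ε, t + 2ε]
stays inside (0, α) and gives a C² function on [0, b'], to which `QPos.qform_cfc_convex` applies; as
ε → 0, continuity of f at 0 suffices. -/
theorem isMatrixConvex_of_qPos {m : ℕ} {α : EReal} (hα : 0 < α) {f f' : ℝ → ℝ}
    (hfc : ContinuousOn f (leftClosedInterval α))
    (hf : ∀ t ∈ openInterval α, HasDerivAt f (f' t) t) (hf' : ContinuousOn f' (openInterval α))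
    (hQ : QPos m (openInterval α) f f') : IsMatrixConvex m (leftClosedInterval α) f := by
  intro A B hA hB hAs hBs c hc0 hc1
  set J := openInterval α with hJdef
  have hJo : IsOpen J := isOpen_openInterval α
  have hJc : J.OrdConnected := ordConnected_openInterval α
  have hM := isHermitian_convexComb hA hB c
  have hcfc : ∀ D : Matrix (Fin m) (Fin m) ℂ, (cfc f D).IsHermitian := fun D =>
    cfc_predicate f D
  rw [posSemidef_iff_qform]
  refine ⟨(((hcfc A).real_smul c).add ((hcfc B).real_smul (1 - c))).sub (hcfc _), fun x => ?_⟩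
  rw [qform_sub, qform_add, qform_smul, qform_smul, sub_nonneg]
  obtain ⟨b, hb, hAb, hBb⟩ := exists_spectrum_subset_Icc hα hAs hBs
  obtain ⟨β, hβ, hbβ⟩ := exists_mem_openInterval_gt hb
  have hMb := spectrum_convexComb_subset hA hB hAb hBb hc0 hc1
  set b' := (b + β) / 2 with hb'
  have hbb' : b < b' := by rw [hb']; linarith
  have hb'β : b' < β := by rw [hb']; linarith
  set F : ℝ → ℝ → ℝ := fun ε t => steklov f ε (t + ε) with hF
  have hlim : ∀ {D : Matrix (Fin m) (Fin m) ℂ}, D.IsHermitian → spectrum ℝ D ⊆ Icc 0 b →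
      Tendsto (fun ε => qform (cfc (F ε) D) x) (𝓝[>] 0) (𝓝 (qform (cfc f D) x)) := by
    intro D hD hDb
    refine tendsto_qform_cfc hD (fun t ht => ?_) x
    have htb := hDb ht
    have := tendsto_steklov (f := f) (t := t) (η := β - b) (c := 1) (by linarith) zero_le_one
      (hfc.mono fun y hy => ⟨htb.1.trans hy.1, lt_of_le_of_lt
        (EReal.coe_le_coe_iff.2 (by linarith [hy.2, htb.2])) hβ.2⟩)
    simpa only [one_mul] using this
  refine le_of_tendsto_of_tendsto (hlim hM hMb)
    (((hlim hA hAb).const_mul c).add ((hlim hB hBb).const_mul (1 - c))) ?_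
  -- For t ≤ b' the window ends at t + 2ε, which this bound keeps below β.
  have hsmall : ∀ᶠ ε : ℝ in 𝓝[>] 0, ε < (β - b') / 2 :=
    nhdsWithin_le_nhds (Iio_mem_nhds (by linarith))
  filter_upwards [self_mem_nhdsWithin, hsmall] with ε hε hεβ
  have hε : 0 < ε := hε
  have hfJ : ContinuousOn f J := hfc.mono (openInterval_subset_leftClosedInterval α)
  have hmem : ∀ t, 0 < t → t ≤ β → t ∈ J := fun t h1 h2 =>
    Ioc_zero_subset_openInterval hβ ⟨h1, h2⟩
  have hsub : ∀ t ∈ Icc ε (b' + ε), Icc t (t + ε) ⊆ J := fun t ht y hy =>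
    hmem y (by linarith [ht.1, hy.1]) (by linarith [ht.2, hy.2])
  have hshift : ∀ t ∈ Icc (0 : ℝ) b', t + ε ∈ Icc ε (b' + ε) := fun t ht =>
    ⟨by linarith [ht.1], by linarith [ht.2]⟩
  have hQF : QPos m (Icc 0 b') (F ε) (fun t => steklov f' ε (t + ε)) :=
    (hQ.steklov hε.le hfJ hf' hsub).comp_add hshift
  have hder : ∀ {k : ℝ → ℝ}, ContinuousOn k J → ∀ t ∈ Icc (0 : ℝ) b',
      HasDerivAt (fun t => steklov k ε (t + ε)) ((k (t + ε + ε) - k (t + ε)) / ε) t := by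
    intro k hk t ht
    have h := hsub _ (hshift t ht)
    exact (hasDerivAt_steklov hJo hJc hk (h ⟨le_rfl, by linarith⟩)
      (h ⟨by linarith, le_rfl⟩)).comp_add_const t ε
  refine hQF.qform_cfc_convex (g'' := fun t => (f' (t + ε + ε) - f' (t + ε)) / ε) hb.1 hbb'
    (fun t ht => ?_) (hder hf') ?_ hA hB hAb hBb hc0 hc1 x
  · have h := hsub _ (hshift t ht)
    rw [steklov_deriv hε.le (fun r hr => hf r (h hr)) (hf'.mono h)]
    exact hder hfJ t ht
  · refine ((hf'.comp (by fun_prop) fun t ht => hsub _ (hshift t ht) ⟨by linarith, le_rfl⟩).sub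
      (hf'.comp (by fun_prop) fun t ht => hsub _ (hshift t ht) ⟨le_rfl, by linarith⟩)).div_const ε

/-- The first divided differences of (f(t) - f(0)) / t are by definition `slopeQ` with base point 0,
so monotonicity supplies the starting value for `LCPos.qPos`. -/
theorem isMatrixConvex_of_isMatrixMonotone {m : ℕ} {α : EReal} (hα : 0 < α) {f : ℝ → ℝ}
    (hf : f ∈ classQ (m + 1) (leftClosedInterval α))
    (hmono : IsMatrixMonotone m (openInterval α) fun t => (f t - f 0) / t) :
    IsMatrixConvex m (leftClosedInterval α) f := by
  have hfc : ContinuousOn f (leftClosedInterval α) := hf.1.continuousOn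
  have hd := fun t (ht : t ∈ openInterval α) => hasDerivAt_of_mem_classQ hf ht
  have hd' : ContinuousOn (deriv f) (openInterval α) :=
    (hf.1.mono (openInterval_subset_leftClosedInterval α)).continuousOn_deriv_of_isOpen
      (isOpen_openInterval α) le_rfl
  obtain ⟨β, hβ, hβ0⟩ := exists_mem_openInterval_gt (α := α) (b := 0) ⟨le_rfl, hα⟩
  have hf0 : Tendsto f (𝓝[>] 0) (𝓝 (f 0)) := by
    refine (hfc 0 ⟨le_rfl, hα⟩).tendsto.mono_left (nhdsWithin_le_iff.2 ?_)
    filter_upwards [Ioc_mem_nhdsGT hβ0] with t ht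
    exact openInterval_subset_leftClosedInterval α (Ioc_zero_subset_openInterval hβ ht)
  refine isMatrixConvex_of_qPos hα hfc hd hd' ((lCPos_of_mem_classQ hf).qPos
    (isOpen_openInterval α) (fun t ht => ⟨ht.1, Ioc_zero_subset_openInterval ht⟩) hd hd' hf0
    fun s _ hsJ x => ?_)
  have hne : ∀ t ∈ openInterval α, t ≠ 0 := fun t ht => ht.1.ne'
  have h := hmono.sum_slopeL_nonneg (isOpen_openInterval α) (ordConnected_openInterval α)
    ⟨β, hβ⟩ (h' := fun t => (deriv f t - (f t - f 0) / t) / t) (fun t ht => by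
      refine (((hd t ht).sub_const (f 0)).fun_div (hasDerivAt_id' t) (hne t ht)).congr_deriv ?_
      have := hne t ht
      field_simp) ?_ hsJ x
  · simpa [slopeQ] using h
  · exact (hd'.sub (((hfc.mono (openInterval_subset_leftClosedInterval α)).sub
      continuousOn_const).div continuousOn_id hne)).div continuousOn_id hne

theorem mainTheorem1 (n : ℕ) (hn : 2 ≤ n) (α : EReal) (hα : 0 < α) (f : ℝ → ℝ)
    (hf : f ∈ classQ n (leftClosedInterval α)) :
    (IsMatrixMonotone (n - 1) (openInterval α) (fun t => (f t - f 0) / t) →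
      IsMatrixConvex (n - 1) (leftClosedInterval α) f) ∧
    (f 0 = 0 → IsMatrixMonotone (n - 1) (openInterval α) (fun t => f t / t) →
      IsMatrixConvex (n - 1) (leftClosedInterval α) f) := by
  obtain ⟨m, rfl⟩ : ∃ m, n = m + 1 := ⟨n - 1, by omega⟩
  rw [Nat.add_sub_cancel]
  refine ⟨isMatrixConvex_of_isMatrixMonotone hα hf, fun h0 hmono =>
    isMatrixConvex_of_isMatrixMonotone hα hf ?_⟩
  simpa only [h0, sub_zero] using hmono
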